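/- Let $n\ge 2$ be an even integer. For a positive integer $m$ let $[m]=\{1,\dots,m\}$. A $(1,2)$-configuration of $[m]$ is a set of pairwise disjoint subsets of $[m]$, each of cardinality $1$ (a ball) or $2$ (an arc); it is noncrossing if it has no two arcs $\{i_1,j_1\},\{i_2,j_2\}$ with $i_1<i_2<j_1<j_2$. Let $X_n$ be the set of noncrossing $(1,2)$-configurations of $[n-1]$. Let $I_2(n-1)=\langle r,s\mid r^{n-1}=s^2=1,\ rs=sr^{-1}\rangle$ be the dihedral group of order $2(n-1)$. It acts on $[n-1]$, where $r$ is the rotation $i\mapsto i+1$ for $i\ne n-1$, $n-1\mapsto 1$, and $s$ is the reflection $i\mapsto n-i$, and hence it acts on $X_n$. Let $\mathrm{Rep}(G)$ denote the representation ring, with integer coefficients, of finite-dimensional complex representations of a finite group $G$ (with $[U]+[V]=[U\oplus V]$, $[U][V]=[U\otimes V]$, and the class of the trivial representation as unit). Let $z_1$ be the two-dimensional representation of $I_2(n-1)$ given by $$r\mapsto\begin{pmatrix}\cos\frac{2\pi}{n-1}&-\sin\frac{2\pi}{n-1}\\ \sin\frac{2\pi}{n-1}&\cos\frac{2\pi}{n-1}\end{pmatrix},\qquad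 s\mapsto\begin{pmatrix}0&1\\1&0\end{pmatrix},$$ let $\det$ be its determinant (the one-dimensional representation $r\mapsto 1$, $s\mapsto -1$), and let $-\det$ stand for the element $-[\det]$ of $\mathrm{Rep}(I_2(n-1))$. Define polynomials in $q,t$ by $\{0\}_{q,t}=0$, $\{1\}_{q,t}=1$, $\{k+2\}_{q,t}=q\{k+1\}_{q,t}+t\{k\}_{q,t}$, and put $\{k\}!_{q,t}=\{k\}_{q,t}\{k-1\}_{q,t}\cdots\{1\}_{q,t}$ and $$\begin{Bmatrix}a\\k\end{Bmatrix}_{q,t}=\frac{\{a\}!_{q,t}}{\{k\}!_{q,t}\{a-k\}!_{q,t}},\qquad X(q,t)=\frac{1}{\{n+1\}_{q,t}}\begin{Bmatrix}2n\\n\end{Bmatrix}_{q,t}.$$ Then $X(q,t)$ is a polynomial in $q,t$ with integer coefficients, and the quadruple $(X_n,\ I_2(n-1),\ \{z_1,-\det\},\ X(q,t))$ exhibits dihedral sieving: the elements $[z_1]$ and $-[\det]$ generate $\mathrm{Rep}(I_2(n-1))$ as a ring, and the class of the permutation representation $\mathbb C[X_n]$ satisfies $$[\mathbb C[X_n]]=X([z_1],-[\det])\quad\text{in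 }\mathrm{Rep}(I_2(n-1)).$$ -/

import Mathlib

open CategoryTheory

namespace DihedralSieving

/-! ## The representation ring and `G`-sieving -/

section RepRing

/-- Isomorphism classes of finite-dimensional complex representations of `G`. -/
abbrev IsoClass (G : Type) [Group G] : Type 1 :=
  Quotient (isIsomorphicSetoid (FDRep ℂ G))

/-- The isomorphism class `[V]` of a finite-dimensional complex representation. -/
noncomputable def isoClass {G : Type} [Group G] {V : Type} [AddCommGroup V] [Module ℂ V]
    [Module.Finite ℂ V] (ρ : Representation ℂ G V) : IsoClass G :=
  Quotient.mk (isIsomorphicSetoid (FDRep ℂ G)) (FDRep.of ρ)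

/-- The defining relations of the representation ring, inside the polynomial ring over `ℤ` that is
freely generated by the isomorphism classes of representations: `[U ⊕ V] = [U] + [V]`,
`[U ⊗ V] = [U] [V]`, and the class of the trivial representation is the unit. -/
inductive RepRel (G : Type) [Group G] : MvPolynomial (IsoClass G) ℤ → Prop
  | add (U V : FDRep ℂ G) : RepRel G
      (MvPolynomial.X (isoClass (Representation.prod U.ρ V.ρ)) -
        (MvPolynomial.X (isoClass U.ρ) + MvPolynomial.X (isoClass V.ρ)))
  | mul (U V : FDRep ℂ G) : RepRel G
      (MvPolynomial.X (isoClass (Representation.tprod U.ρ V.ρ)) -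
        MvPolynomial.X (isoClass U.ρ) * MvPolynomial.X (isoClass V.ρ))
  | one : RepRel G (MvPolynomial.X (isoClass (Representation.trivial ℂ G ℂ)) - 1)

/-- The representation ring `Rep(G)` with integer coefficients. -/
abbrev RepRing (G : Type) [Group G] : Type 1 :=
  MvPolynomial (IsoClass G) ℤ ⧸ Ideal.span {p | RepRel G p}

/-- The class `[V]` of a finite-dimensional complex representation in `Rep(G)`. -/
noncomputable def repClass {G : Type} [Group G] {V : Type} [AddCommGroup V] [Module ℂ V]
    [Module.Finite ℂ V] (ρ : Representation ℂ G V) : RepRing G :=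
  Ideal.Quotient.mk (Ideal.span {p | RepRel G p}) (MvPolynomial.X (isoClass ρ))

/-- `(X, G, (ρ₁, …, ρₖ), P)` exhibits `G`-sieving: the elements `ρ₁, …, ρₖ` generate `Rep(G)` as a
ring, and the class of the permutation representation `ℂ[X]` is `P(ρ₁, …, ρₖ)`. The `ρᵢ` are
elements of `Rep(G)`, so that a virtual representation such as `-det` is allowed. -/
def ExhibitsSieving (X : Type) [Finite X] (G : Type) [Group G] [MulAction G X] {k : ℕ}
    (ρ : Fin k → RepRing G) (P : MvPolynomial (Fin k) ℤ) : Prop :=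
  Algebra.adjoin ℤ (Set.range ρ) = ⊤ ∧
    repClass (Representation.ofMulAction ℂ G X) = MvPolynomial.aeval ρ P

end RepRing

/-! ## Homomorphisms out of the dihedral group and its generating representations -/

section Dihedral

/-- The homomorphism on `I₂(m) = ⟨r, s | r ^ m = s ^ 2 = 1, r s = s r⁻¹⟩` with `r ↦ a`, `s ↦ b`.
Here `r = r 1` and `s = sr 0`, so that `sr i = s r ^ i`. -/
def dihedralLift {H : Type*} [Group H] (m : ℕ) (a b : H) (ha : a ^ m = 1) (hb : b * b = 1)
    (hab : a * b = b * a⁻¹) : DihedralGroup m →* H :=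
  have key : ∀ i j : ℤ, (i : ZMod m) = (j : ZMod m) → a ^ i = a ^ j := by
    intro i j h
    rw [ZMod.intCast_eq_intCast_iff_dvd_sub] at h
    obtain ⟨c, hc⟩ := h
    have : j = i + m * c := by omega
    rw [this, zpow_add, zpow_mul, zpow_natCast, ha, one_zpow, mul_one]
  have conj : ∀ i : ℤ, a ^ i * b = b * a ^ (-i) := by
    intro i
    have h1 : a = b * a⁻¹ * b⁻¹ := by rw [← hab]; group
    have h2 : a ^ i = b * (a⁻¹) ^ i * b⁻¹ := by
      conv_lhs => rw [h1]
      exact conj_zpow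
    rw [h2]; simp
  { toFun := fun g => match g with
      | .r i => a ^ (i.cast : ℤ)
      | .sr i => b * a ^ (i.cast : ℤ)
    map_one' := by
      change a ^ ((0 : ZMod m).cast : ℤ) = 1
      simp
    map_mul' := by
      rintro (i | i) (j | j)
      · change a ^ ((i + j).cast : ℤ) = a ^ (i.cast : ℤ) * a ^ (j.cast : ℤ)
        rw [← zpow_add]
        exact key _ _ (by simp)
      · change b * a ^ ((j - i).cast : ℤ) = a ^ (i.cast : ℤ) * (b * a ^ (j.cast : ℤ))
        rw [← mul_assoc, conj, mul_assoc, ← zpow_add]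
        congr 1
        exact key _ _ (by simp; ring)
      · change b * a ^ ((i + j).cast : ℤ) = b * a ^ (i.cast : ℤ) * a ^ (j.cast : ℤ)
        rw [mul_assoc, ← zpow_add]
        congr 1
        exact key _ _ (by simp)
      · change a ^ ((j - i).cast : ℤ) = b * a ^ (i.cast : ℤ) * (b * a ^ (j.cast : ℤ))
        rw [mul_assoc, ← mul_assoc (a ^ _), conj, mul_assoc, ← mul_assoc, hb, one_mul, ← zpow_add]
        exact key _ _ (by simp; ring) }

/-- The rotation matrix by the angle `θ`. -/
noncomputable def rotMatrix (θ : ℝ) : Matrix (Fin 2) (Fin 2) ℂ :=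
  !![(Real.cos θ : ℂ), -(Real.sin θ : ℂ); (Real.sin θ : ℂ), (Real.cos θ : ℂ)]

theorem rotMatrix_mul (θ φ : ℝ) : rotMatrix θ * rotMatrix φ = rotMatrix (θ + φ) := by
  ext i j
  fin_cases i <;> fin_cases j <;>
    simp [rotMatrix, Matrix.mul_apply, Complex.cos_add, Complex.sin_add] <;> ring

theorem rotMatrix_zero : rotMatrix 0 = 1 := by
  ext i j
  fin_cases i <;> fin_cases j <;> simp [rotMatrix]

theorem rotMatrix_two_pi : rotMatrix (2 * Real.pi) = 1 := by
  ext i j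
  fin_cases i <;> fin_cases j <;> simp [rotMatrix]

theorem rotMatrix_pow (θ : ℝ) (k : ℕ) : rotMatrix θ ^ k = rotMatrix (k * θ) := by
  induction k with
  | zero => simp [rotMatrix_zero]
  | succ k ih => rw [pow_succ, ih, rotMatrix_mul]; congr 1; push_cast; ring

/-- The rotation matrix by the angle `θ`, as an invertible matrix. -/
noncomputable def rotUnit (θ : ℝ) : (Matrix (Fin 2) (Fin 2) ℂ)ˣ where
  val := rotMatrix θ
  inv := rotMatrix (-θ)
  val_inv := by rw [rotMatrix_mul, add_neg_cancel, rotMatrix_zero]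
  inv_val := by rw [rotMatrix_mul, neg_add_cancel, rotMatrix_zero]

/-- The matrix that swaps the two coordinates, as an invertible matrix. -/
noncomputable def swapUnit : (Matrix (Fin 2) (Fin 2) ℂ)ˣ where
  val := !![0, 1; 1, 0]
  inv := !![0, 1; 1, 0]
  val_inv := by simp [Matrix.one_fin_two]
  inv_val := by simp [Matrix.one_fin_two]

/-- The matrix form of `z₁`: `r` goes to the rotation by `2π/m`, `s` to the coordinate swap. -/
noncomputable def z1Matrix (m : ℕ) : DihedralGroup m →* (Matrix (Fin 2) (Fin 2) ℂ)ˣ :=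
  dihedralLift m (rotUnit (2 * Real.pi / m)) swapUnit
    (by
      ext1
      rw [Units.val_pow_eq_pow_val]
      change rotMatrix _ ^ m = 1
      rw [rotMatrix_pow]
      rcases Nat.eq_zero_or_pos m with h | h
      · subst h; simp [rotMatrix_zero]
      · have hm : (m : ℝ) ≠ 0 := by positivity
        rw [mul_div_cancel₀ _ hm, rotMatrix_two_pi])
    (by ext1; exact swapUnit.val_inv)
    (by
      ext1
      change rotMatrix (2 * Real.pi / m) * !![0, 1; 1, 0] =
        !![0, 1; 1, 0] * rotMatrix (-(2 * Real.pi / m))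
      simp only [rotMatrix, Matrix.mul_fin_two, Real.cos_neg, Real.sin_neg]
      simp)

/-- The two-dimensional representation `z₁` of `I₂(m)`. -/
noncomputable def z1 (m : ℕ) : Representation ℂ (DihedralGroup m) (Fin 2 → ℂ) :=
  (Matrix.toLinAlgEquiv' (R := ℂ) (n := Fin 2)).toMulEquiv.toMonoidHom.comp
    ((Units.coeHom _).comp (z1Matrix m))

/-- The one-dimensional representation `det` of `I₂(m)`: the determinant of `z₁`, that is,
`r ↦ 1` and `s ↦ -1`. -/
noncomputable def detRep (m : ℕ) : Representation ℂ (DihedralGroup m) ℂ where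
  toFun g := LinearMap.lsmul ℂ ℂ (z1Matrix m g : Matrix (Fin 2) (Fin 2) ℂ).det
  map_one' := by ext; simp
  map_mul' g h := by ext; simp [Matrix.det_mul]

end Dihedral

/-! ## Noncrossing (1,2)-configurations -/

section Config

/-- Noncrossing (1,2)-configurations of `[m]`: sets of pairwise disjoint balls (one-element
subsets) and arcs (two-element subsets) without arcs `{i₁, j₁}`, `{i₂, j₂}` such that
`i₁ < i₂ < j₁ < j₂`. The element `i` of `Fin m` stands for the vertex `i + 1` of
`[m] = {1, …, m}`. -/
structure IsNCConfig {m : ℕ} (x : Finset (Finset (Fin m))) : Prop where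
  card_block : ∀ b ∈ x, b.card = 1 ∨ b.card = 2
  disjoint : ∀ b ∈ x, ∀ c ∈ x, b ≠ c → Disjoint b c
  noncrossing : ¬ ∃ i₁ i₂ j₁ j₂ : Fin m, i₁ < i₂ ∧ i₂ < j₁ ∧ j₁ < j₂ ∧
    ({i₁, j₁} : Finset (Fin m)) ∈ x ∧ ({i₂, j₂} : Finset (Fin m)) ∈ x

/-- The set `X_n` of noncrossing (1,2)-configurations of `[n - 1]`. -/
abbrev NCConfig (n : ℕ) : Type := {x : Finset (Finset (Fin (n - 1))) // IsNCConfig x}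

/-- The image of a set of blocks under a permutation of the vertices. -/
def mapBlocks {m : ℕ} (σ : Equiv.Perm (Fin m)) (x : Finset (Finset (Fin m))) :
    Finset (Finset (Fin m)) :=
  x.image fun b => b.image σ

theorem mapBlocks_one {m : ℕ} (x : Finset (Finset (Fin m))) : mapBlocks 1 x = x := by
  simp [mapBlocks]

theorem mapBlocks_mul {m : ℕ} (σ τ : Equiv.Perm (Fin m)) (x : Finset (Finset (Fin m))) :
    mapBlocks (σ * τ) x = mapBlocks σ (mapBlocks τ x) := by
  simp [mapBlocks, Finset.image_image, Function.comp_def]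

theorem pair_mem_mapBlocks {m : ℕ} (σ : Equiv.Perm (Fin m)) (x : Finset (Finset (Fin m)))
    (i j : Fin m) : ({i, j} : Finset (Fin m)) ∈ mapBlocks σ x ↔
      ({σ.symm i, σ.symm j} : Finset (Fin m)) ∈ x := by
  constructor
  · intro h
    obtain ⟨b, hb, h⟩ := Finset.mem_image.1 h
    have : b = {σ.symm i, σ.symm j} := by
      apply Finset.image_injective σ.injective
      rw [h]; simp [Finset.image_insert]
    rwa [← this]
  · intro h
    exact Finset.mem_image.2 ⟨_, h, by simp [Finset.image_insert]⟩

/-- The rotation `i ↦ i + 1` (and `m ↦ 1`) of the vertices of `[m]`. -/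
def rotation (m : ℕ) : Equiv.Perm (Fin m) := finRotate m

/-- The reflection `i ↦ m + 1 - i` of the vertices of `[m]`; for `m = n - 1` it is `i ↦ n - i`. -/
def reflection (m : ℕ) : Equiv.Perm (Fin m) := Fin.revPerm

theorem rotation_val {m : ℕ} (i : Fin m) :
    (rotation m i).val = if i.val + 1 = m then 0 else i.val + 1 := by
  cases m with
  | zero => exact i.elim0
  | succ k =>
    rw [rotation, finRotate_apply]
    rw [Fin.val_add_one]
    simp [Fin.ext_iff]

theorem rotation_pow_val {m : ℕ} (k : ℕ) (i : Fin m) :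
    ((rotation m ^ k) i).val = (i.val + k) % m := by
  induction k with
  | zero => simp [Nat.mod_eq_of_lt i.2]
  | succ k ih =>
    have h := Nat.mod_lt (i.val + k) (lt_of_le_of_lt (Nat.zero_le _) i.2)
    have e : (i.val + (k + 1)) % m = ((i.val + k) % m + 1) % m := by simp [← add_assoc]
    rw [pow_succ', Equiv.Perm.mul_apply, rotation_val, ih, e]
    split_ifs with h1
    · rw [h1, Nat.mod_self]
    · exact (Nat.mod_eq_of_lt (by omega)).symm

/-- The action of `I₂(m)` on the vertices: `r` acts as the rotation, `s` as the reflection. -/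
def vertexHom (m : ℕ) : DihedralGroup m →* Equiv.Perm (Fin m) :=
  dihedralLift m (rotation m) (reflection m)
    (by ext i; rw [rotation_pow_val]; simp [Nat.mod_eq_of_lt i.2])
    (by ext i; simp [reflection])
    (by
      rw [eq_mul_inv_iff_mul_eq]
      ext i
      have h1 := rotation_val i
      have h2 := rotation_val (Fin.rev (rotation m i))
      have h3 := Fin.val_rev (rotation m i)
      have h4 := Fin.val_rev i
      have hi := i.2
      simp only [Equiv.Perm.mul_apply, reflection, Fin.revPerm_apply]
      rw [h2, h3, h4, h1]
      split_ifs <;> omega)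

theorem IsNCConfig.map_of_noncrossing {m : ℕ} (σ : Equiv.Perm (Fin m))
    {x : Finset (Finset (Fin m))} (hx : IsNCConfig x)
    (h : ¬ ∃ i₁ i₂ j₁ j₂ : Fin m, i₁ < i₂ ∧ i₂ < j₁ ∧ j₁ < j₂ ∧
      ({i₁, j₁} : Finset (Fin m)) ∈ mapBlocks σ x ∧
      ({i₂, j₂} : Finset (Fin m)) ∈ mapBlocks σ x) : IsNCConfig (mapBlocks σ x) where
  card_block := by
    intro b hb
    obtain ⟨b', hb', rfl⟩ := Finset.mem_image.1 hb
    rw [Finset.card_image_of_injective _ σ.injective]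
    exact hx.card_block b' hb'
  disjoint := by
    intro b hb c hc hbc
    obtain ⟨b', hb', rfl⟩ := Finset.mem_image.1 hb
    obtain ⟨c', hc', rfl⟩ := Finset.mem_image.1 hc
    rw [Finset.disjoint_image σ.injective]
    exact hx.disjoint _ hb' _ hc' fun h => hbc (by rw [h])
  noncrossing := h

theorem IsNCConfig.map_reflection {m : ℕ} {x : Finset (Finset (Fin m))} (hx : IsNCConfig x) :
    IsNCConfig (mapBlocks (reflection m) x) := by
  refine hx.map_of_noncrossing _ ?_
  rintro ⟨i₁, i₂, j₁, j₂, h1, h2, h3, h4, h5⟩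
  rw [pair_mem_mapBlocks] at h4 h5
  refine hx.noncrossing ⟨j₂.rev, j₁.rev, i₂.rev, i₁.rev, Fin.rev_lt_rev.2 h3,
    Fin.rev_lt_rev.2 h2, Fin.rev_lt_rev.2 h1, ?_, ?_⟩
  · rw [Finset.pair_comm]; exact h5
  · rw [Finset.pair_comm]; exact h4

theorem IsNCConfig.map_rotation {m : ℕ} {x : Finset (Finset (Fin m))} (hx : IsNCConfig x) :
    IsNCConfig (mapBlocks (rotation m) x) := by
  refine hx.map_of_noncrossing _ ?_
  rintro ⟨i₁, i₂, j₁, j₂, h1, h2, h3, h4, h5⟩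
  rw [pair_mem_mapBlocks] at h4 h5
  have e1 := rotation_val ((rotation m).symm i₁)
  have e2 := rotation_val ((rotation m).symm i₂)
  have e3 := rotation_val ((rotation m).symm j₁)
  have e4 := rotation_val ((rotation m).symm j₂)
  rw [Equiv.apply_symm_apply] at e1 e2 e3 e4
  rw [Fin.lt_def] at h1 h2 h3
  by_cases h : ((rotation m).symm i₁).val + 1 = m
  · rw [Finset.pair_comm] at h4
    refine hx.noncrossing ⟨_, _, _, _, ?_, ?_, ?_, h5, h4⟩ <;>
      rw [Fin.lt_def] <;> split_ifs at e1 e2 e3 e4 <;> omega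
  · refine hx.noncrossing ⟨_, _, _, _, ?_, ?_, ?_, h4, h5⟩ <;>
      rw [Fin.lt_def] <;> split_ifs at e1 e2 e3 e4 <;> omega

theorem IsNCConfig.map_vertexHom {m : ℕ} (g : DihedralGroup m) {x : Finset (Finset (Fin m))}
    (hx : IsNCConfig x) : IsNCConfig (mapBlocks (vertexHom m g) x) := by
  have hpow : ∀ (k : ℕ), IsNCConfig (mapBlocks (rotation m ^ k) x) := by
    intro k
    induction k with
    | zero => rw [pow_zero, mapBlocks_one]; exact hx
    | succ k ih => rw [pow_succ', mapBlocks_mul]; exact ih.map_rotation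
  have hzpow : ∀ (k : ℤ), IsNCConfig (mapBlocks (rotation m ^ k) x) := by
    intro k
    obtain ⟨l, hl⟩ := mem_powers_iff_mem_zpowers.2
      (Subgroup.zpow_mem_zpowers (rotation m) k)
    dsimp only at hl
    rw [← hl]
    exact hpow l
  cases g with
  | r i => exact hzpow _
  | sr i =>
    change IsNCConfig (mapBlocks (reflection m * rotation m ^ (i.cast : ℤ)) x)
    rw [mapBlocks_mul]
    exact (hzpow _).map_reflection

/-- The action of `I₂(n - 1)` on `X_n`: group elements move the vertices of every block. -/
instance (n : ℕ) : MulAction (DihedralGroup (n - 1)) (NCConfig n) where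
  smul g x := ⟨mapBlocks (vertexHom (n - 1) g) x.1, x.2.map_vertexHom g⟩
  one_smul x := Subtype.ext (by
    change mapBlocks (vertexHom (n - 1) 1) x.1 = x.1
    rw [map_one, mapBlocks_one])
  mul_smul g h x := Subtype.ext (by
    change mapBlocks (vertexHom (n - 1) (g * h)) x.1 =
      mapBlocks (vertexHom (n - 1) g) (mapBlocks (vertexHom (n - 1) h) x.1)
    rw [map_mul, mapBlocks_mul])

end Config

/-! ## Generalized Fibonacci polynomials -/

section Fibonacci

open MvPolynomial

/-- The generalized Fibonacci polynomials `{n}_{q,t}`, where `q = X 0` and `t = X 1`. -/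
noncomputable def fibPoly : ℕ → MvPolynomial (Fin 2) ℤ
  | 0 => 0
  | 1 => 1
  | n + 2 => X 0 * fibPoly (n + 1) + X 1 * fibPoly n

/-- `{n}!_{q,t} = {n}_{q,t} {n-1}_{q,t} ⋯ {1}_{q,t}`. -/
noncomputable def fibFactorial (n : ℕ) : MvPolynomial (Fin 2) ℤ :=
  ∏ i ∈ Finset.range n, fibPoly (i + 1)

/-- The Fibonomial coefficient, as a quotient in the field of rational functions `ℚ(q,t)`. -/
noncomputable def fibonomial (n k : ℕ) : FractionRing (MvPolynomial (Fin 2) ℤ) :=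
  algebraMap _ _ (fibFactorial n) /
    (algebraMap _ _ (fibFactorial k) * algebraMap _ _ (fibFactorial (n - k)))

/-- The Fibonomial `q,t`-Catalan number `{2n choose n}_{q,t} / {n+1}_{q,t}`. -/
noncomputable def fibCatalan (n : ℕ) : FractionRing (MvPolynomial (Fin 2) ℤ) :=
  fibonomial (2 * n) n / algebraMap _ _ (fibPoly (n + 1))

end Fibonacci

end DihedralSieving

/-!
Write `m = n - 1`, an odd number. The proof compares characters. For odd `m` an element of
`Rep(I₂(m))` is determined by its character (`eq_of_charHom_eq`): an eigenvector of the rotation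
generates a copy of the trivial representation, of `det`, or of a two-dimensional representation
`weightRep k`, which splits off by Maschke's theorem, so that the classes of these representations
span; their coefficients are then recovered from the character by Fourier inversion on `ZMod m`.
The same comparison gives `[y₀] = 1 + [det]`, `[y₁] = [z₁]` and
`[yₖ₊₂] = [z₁][yₖ₊₁] - [yₖ]` for the classes of `yₖ = weightRep k`, whence `z₁` and `-det` generate
the ring (`adjoin_z1_det`).

It remains to see, for each group element `g`, that the number of configurations fixed by `g` is
the value of the Fibonomial Catalan polynomial at the pair `(tr z₁(g), -det(g))`. This pair is
`(ω + ω⁻¹, -1)`, for a root of unity `ω` of order `d ∣ m`, when `g` is a rotation of order `d`, and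
`(0, 1)` when `g` is a reflection.

*Values of the polynomial.* At these points the values `{k}` are periodic in `k` with period `d`
(with period two for reflections), and `{dk} / {d}` takes the value `k`. After the factors `{d}` are
cancelled, the product formula leaves the Catalan number for `d = 1`
(`aeval_fibCatalanPoly_two`), the binomial coefficient `(2e choose e)` with `e = m / d` for `d ≥ 3`
(`aeval_fibCatalanPoly_root`), and `(n choose n / 2)` for reflections
(`aeval_fibCatalanPoly_zero_one`).

*Fixed configurations.* A configuration is a noncrossing involution together with a set of fixed
points, the balls. A noncrossing involution of a line is determined by its sets of left and right
endpoints (`IsNCInvolution.eq_of_lt_iff`), and any arrangement of endpoints whose height function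
returns to each level it leaves comes from one (`exists_isNCInvolution`). Thus configurations of
`[m]` correspond to ballot words in four letters, counted by the reflection principle; those
fixed by a reflection correspond to symmetric words, that is, to half words of nonnegative height
together with the colour of the central vertex. A configuration fixed by a rotation by `e ≤ m / 3`
lifts to an `e`-periodic noncrossing involution of the integers, since its arcs, taken the short way
around, are shorter than `e` (`isNCInvolution_cyclicLift`); such configurations correspond to words
of length `e` and total height zero, of which there are `(2e choose e)` (`card_fixed_rotation`).
-/

namespace DihedralSieving

/-! ### The representation ring and characters -/

section RepRingTheory

variable {G : Type} [Group G]

/-- The trace of `g` on an isomorphism class of representations. -/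
noncomputable def isoClassTrace (g : G) : IsoClass G → ℂ :=
  Quotient.lift (fun V : FDRep ℂ G => V.character g) (by
    rintro V W ⟨i⟩
    exact congrFun (FDRep.char_iso i) g)

theorem isoClassTrace_isoClass (g : G) {V : Type} [AddCommGroup V] [Module ℂ V]
    [Module.Finite ℂ V] (ρ : Representation ℂ G V) :
    isoClassTrace g (isoClass ρ) = LinearMap.trace ℂ V (ρ g) := rfl

/-- The character value at `g`, as a ring homomorphism from the representation ring. -/
noncomputable def charHom (g : G) : RepRing G →+* ℂ :=
  Ideal.Quotient.lift _
    (MvPolynomial.aeval (R := ℤ) (isoClassTrace g)).toRingHom (by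
      intro p hp
      change p ∈ RingHom.ker _
      revert p
      change Ideal.span {p | RepRel G p} ≤ _
      rw [Ideal.span_le]
      rintro p (⟨U, V⟩ | ⟨U, V⟩ | _)
      · simp [RingHom.mem_ker, isoClassTrace_isoClass, Representation.prod,
          LinearMap.trace_prodMap']
      · simp [RingHom.mem_ker, isoClassTrace_isoClass, Representation.tprod,
          LinearMap.trace_tensorProduct']
      · simp [RingHom.mem_ker, isoClassTrace_isoClass])

theorem charHom_repClass (g : G) {V : Type} [AddCommGroup V] [Module ℂ V]
    [Module.Finite ℂ V] (ρ : Representation ℂ G V) :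
    charHom g (repClass ρ) = LinearMap.trace ℂ V (ρ g) := by
  change MvPolynomial.aeval (R := ℤ) (isoClassTrace g) (MvPolynomial.X (isoClass ρ)) = _
  rw [MvPolynomial.aeval_X, isoClassTrace_isoClass]

theorem repClass_eq_of_equiv {V W : Type} [AddCommGroup V] [Module ℂ V] [Module.Finite ℂ V]
    [AddCommGroup W] [Module ℂ W] [Module.Finite ℂ W] {ρ : Representation ℂ G V}
    {σ : Representation ℂ G W} (e : V ≃ₗ[ℂ] W) (he : ∀ g v, e (ρ g v) = σ g (e v)) :
    repClass ρ = repClass σ := by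
  have : isoClass ρ = isoClass σ := by
    refine Quotient.sound ⟨Action.mkIso (LinearEquiv.toFGModuleCatIso e) ?_⟩
    intro g
    ext v
    exact he g v
  rw [repClass, repClass, this]

theorem repClass_prod {V W : Type} [AddCommGroup V] [Module ℂ V] [Module.Finite ℂ V]
    [AddCommGroup W] [Module ℂ W] [Module.Finite ℂ W] (ρ : Representation ℂ G V)
    (σ : Representation ℂ G W) : repClass (ρ.prod σ) = repClass ρ + repClass σ := by
  have h := RepRel.add (FDRep.of ρ) (FDRep.of σ)
  have h2 := Ideal.Quotient.eq.2 (Ideal.subset_span h : _ ∈ Ideal.span {p | RepRel G p})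
  rw [map_add] at h2
  exact h2

theorem repClass_tprod {V W : Type} [AddCommGroup V] [Module ℂ V] [Module.Finite ℂ V]
    [AddCommGroup W] [Module ℂ W] [Module.Finite ℂ W] (ρ : Representation ℂ G V)
    (σ : Representation ℂ G W) : repClass (ρ.tprod σ) = repClass ρ * repClass σ := by
  have h := RepRel.mul (FDRep.of ρ) (FDRep.of σ)
  have h2 := Ideal.Quotient.eq.2 (Ideal.subset_span h : _ ∈ Ideal.span {p | RepRel G p})
  rw [map_mul] at h2
  exact h2

theorem repClass_trivial : repClass (Representation.trivial ℂ G ℂ) = 1 := by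
  have h := Ideal.Quotient.eq.2 (Ideal.subset_span RepRel.one : _ ∈ Ideal.span {p | RepRel G p})
  rw [map_one] at h
  exact h

theorem repClass_eq_zero {V : Type} [AddCommGroup V] [Module ℂ V] [Module.Finite ℂ V]
    [Subsingleton V] (ρ : Representation ℂ G V) : repClass ρ = 0 := by
  have h : repClass (ρ.prod ρ) = repClass ρ :=
    repClass_eq_of_equiv (LinearEquiv.ofSubsingleton (V × V) V) fun g v => Subsingleton.elim _ _
  rw [repClass_prod] at h
  exact left_eq_add.1 h.symm

/-- An additive subgroup of the representation ring that contains the class of every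
representation is the whole ring: products of classes are classes. -/
theorem addSubgroup_eq_top_of_repClass_mem (S : AddSubgroup (RepRing G))
    (hS : ∀ V : FDRep ℂ G, repClass V.ρ ∈ S) : S = ⊤ := by
  let T : AddSubgroup (RepRing G) :=
    AddSubgroup.closure {x | ∃ V : FDRep ℂ G, repClass V.ρ = x}
  have hTS : T ≤ S := by
    rw [AddSubgroup.closure_le]
    rintro x ⟨V, rfl⟩
    exact hS V
  have hT1 : (1 : RepRing G) ∈ T :=
    AddSubgroup.subset_closure ⟨FDRep.of (Representation.trivial ℂ G ℂ), repClass_trivial⟩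
  have hmul : ∀ x ∈ T, ∀ V : FDRep ℂ G, x * repClass V.ρ ∈ T := by
    intro x hx V
    induction hx using AddSubgroup.closure_induction with
    | mem x hx =>
      obtain ⟨U, rfl⟩ := hx
      exact AddSubgroup.subset_closure
        ⟨FDRep.of (Representation.tprod U.ρ V.ρ), repClass_tprod U.ρ V.ρ⟩
    | zero => rw [zero_mul]; exact T.zero_mem
    | add x y _ _ hx hy => rw [add_mul]; exact T.add_mem hx hy
    | neg x _ hx =>
      have e : -x * repClass V.ρ = -(x * repClass V.ρ) := neg_mul x _
      rw [e]
      exact T.neg_mem hx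
  rw [eq_top_iff]
  rintro x -
  obtain ⟨p, rfl⟩ := Ideal.Quotient.mk_surjective x
  apply hTS
  induction p using MvPolynomial.induction_on with
  | C a =>
    have : (Ideal.Quotient.mk (Ideal.span {p | RepRel G p})) (MvPolynomial.C a) =
        a • (1 : RepRing G) := by
      rw [← Int.cast_smul_eq_zsmul ℤ]
      simp
    rw [this]
    exact T.zsmul_mem hT1 a
  | add p q hp hq => rw [map_add]; exact T.add_mem hp hq
  | mul_X p i hp =>
    rw [map_mul]
    obtain ⟨V, rfl⟩ := Quotient.exists_rep i
    exact hmul _ hp V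

/-- Maschke's theorem in the representation ring: a subrepresentation splits off. -/
theorem exists_repClass_eq_add [Finite G] {V W : Type} [AddCommGroup V] [Module ℂ V]
    [Module.Finite ℂ V] [AddCommGroup W] [Module ℂ W] [Module.Finite ℂ W]
    {ρ : Representation ℂ G V} {σ : Representation ℂ G W} (f : W →ₗ[ℂ] V)
    (hf : Function.Injective f) (hfg : ∀ g w, f (σ g w) = ρ g (f w)) :
    ∃ τ : FDRep ℂ G, repClass ρ = repClass σ + repClass τ.ρ ∧
      Module.finrank ℂ V = Module.finrank ℂ W + Module.finrank ℂ τ := by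
  have : NeZero (Nat.card G : ℂ) := ⟨Nat.cast_ne_zero.2 Nat.card_pos.ne'⟩
  let A : Subrepresentation ρ := ⟨LinearMap.range f, by
    rintro g _ ⟨w, rfl⟩
    exact ⟨σ g w, hfg g w⟩⟩
  obtain ⟨B, hB⟩ := exists_isCompl A
  have hc : IsCompl A.toSubmodule B.toSubmodule := by
    constructor
    · rw [disjoint_iff]
      exact congrArg Subrepresentation.toSubmodule (disjoint_iff.1 hB.1)
    · rw [codisjoint_iff]
      exact congrArg Subrepresentation.toSubmodule (codisjoint_iff.1 hB.2)
  let e : (W × B.toSubmodule) ≃ₗ[ℂ] V :=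
    ((LinearEquiv.ofInjective f hf).prodCongr (LinearEquiv.refl ℂ _)).trans
      (Submodule.prodEquivOfIsCompl A.toSubmodule B.toSubmodule hc)
  refine ⟨FDRep.of B.toRepresentation, ?_, ?_⟩
  · refine Eq.trans ?_ (repClass_prod σ B.toRepresentation)
    refine (repClass_eq_of_equiv e ?_).symm
    rintro g ⟨w, b⟩
    change f (σ g w) + ρ g b = ρ g (f w + b)
    rw [hfg, map_add]
  · rw [← e.finrank_eq, Module.finrank_prod]

/-- The character of a permutation representation counts fixed points. -/
theorem charHom_ofMulAction {X : Type} [Finite X] [MulAction G X] (g : G) :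
    charHom g (repClass (Representation.ofMulAction ℂ G X)) =
      (Nat.card {x : X // g • x = x} : ℂ) := by
  classical
  have := Fintype.ofFinite X
  rw [charHom_repClass, LinearMap.trace_eq_matrix_trace ℂ (MonoidAlgebra.basis X ℂ),
    Matrix.trace]
  have h : ∀ x : X, LinearMap.toMatrix (MonoidAlgebra.basis X ℂ) (MonoidAlgebra.basis X ℂ)
      (Representation.ofMulAction ℂ G X g) x x = if g • x = x then 1 else 0 := by
    intro x
    rw [LinearMap.toMatrix_apply, MonoidAlgebra.basis_apply, Representation.ofMulAction_single]
    change (MonoidAlgebra.single (g • x) (1 : ℂ)).coeff x = _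
    simp [Finsupp.single_apply]
  simp only [Matrix.diag_apply, h, Finset.sum_boole]
  rw [Nat.card_eq_fintype_card, Fintype.card_subtype]

end RepRingTheory

/-! ### Representations of the dihedral group -/

section DihedralRep

open DihedralGroup ZMod

variable {m : ℕ} [NeZero m]

/-- The representation of `I₂(m)` on `ℂ²` in which `r` acts as `diag(ζᵏ, ζ⁻ᵏ)`, where
`ζ = exp (2πi/m)`, and `s` swaps the coordinates. -/
noncomputable def weightRep (k : ZMod m) : Representation ℂ (DihedralGroup m) (Fin 2 → ℂ) where
  toFun g := Matrix.toLin' (match g with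
    | .r i => !![stdAddChar (k * i), 0; 0, stdAddChar (-(k * i))]
    | .sr i => !![0, stdAddChar (-(k * i)); stdAddChar (k * i), 0])
  map_one' := by
    rw [one_def]
    simp only [mul_zero, neg_zero, AddChar.map_zero_eq_one]
    rw [← Matrix.one_fin_two, Matrix.toLin'_one]
    rfl
  map_mul' := by
    have key : ∀ a b c : ZMod m, a + b = c → (stdAddChar a * stdAddChar b : ℂ) = stdAddChar c := by
      rintro a b _ rfl
      rw [AddChar.map_add_eq_mul]
    rintro (i | i) (j | j) <;>
      simp only [r_mul_r, r_mul_sr, sr_mul_r, sr_mul_sr] <;>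
      rw [Module.End.mul_eq_comp, ← Matrix.toLin'_mul, Matrix.mul_fin_two] <;>
      simp only [mul_zero, zero_mul, add_zero, zero_add] <;>
      congr <;> (symm; apply key; ring)

theorem weightRep_r (k i : ZMod m) (v : Fin 2 → ℂ) :
    weightRep k (r i) v = ![stdAddChar (k * i) * v 0, stdAddChar (-(k * i)) * v 1] := by
  ext j
  fin_cases j <;> simp [weightRep, Matrix.mulVec, dotProduct]

theorem weightRep_sr (k i : ZMod m) (v : Fin 2 → ℂ) :
    weightRep k (sr i) v = ![stdAddChar (-(k * i)) * v 1, stdAddChar (k * i) * v 0] := by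
  ext j
  fin_cases j <;> simp [weightRep, Matrix.mulVec, dotProduct]

theorem charHom_weightRep_r (k i : ZMod m) :
    charHom (r i) (repClass (weightRep k)) = stdAddChar (k * i) + stdAddChar (-(k * i)) := by
  rw [charHom_repClass]
  simp [weightRep, Matrix.trace_fin_two]

theorem charHom_weightRep_sr (k i : ZMod m) :
    charHom (sr i) (repClass (weightRep k)) = 0 := by
  rw [charHom_repClass]
  simp [weightRep, Matrix.trace_fin_two]

theorem dihedralLift_r {H : Type*} [Group H] (a b : H) (ha : a ^ m = 1) (hb : b * b = 1)
    (hab : a * b = b * a⁻¹) (i : ZMod m) : dihedralLift m a b ha hb hab (r i) = a ^ i.val := by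
  change a ^ (i.cast : ℤ) = _
  rw [ZMod.cast_eq_val, zpow_natCast]

theorem dihedralLift_sr {H : Type*} [Group H] (a b : H) (ha : a ^ m = 1) (hb : b * b = 1)
    (hab : a * b = b * a⁻¹) (i : ZMod m) :
    dihedralLift m a b ha hb hab (sr i) = b * a ^ i.val := by
  change b * a ^ (i.cast : ℤ) = _
  rw [ZMod.cast_eq_val, zpow_natCast]

theorem z1Matrix_r (i : ZMod m) : (z1Matrix m (r i) : Matrix (Fin 2) (Fin 2) ℂ) =
    rotMatrix (i.val * (2 * Real.pi / m)) := by
  rw [z1Matrix, dihedralLift_r, Units.val_pow_eq_pow_val]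
  exact rotMatrix_pow _ _

theorem z1Matrix_sr (i : ZMod m) : (z1Matrix m (sr i) : Matrix (Fin 2) (Fin 2) ℂ) =
    !![0, 1; 1, 0] * rotMatrix (i.val * (2 * Real.pi / m)) := by
  rw [z1Matrix, dihedralLift_sr, Units.val_mul, Units.val_pow_eq_pow_val]
  exact congrArg _ (rotMatrix_pow _ _)

theorem detRep_r (i : ZMod m) (c : ℂ) : detRep m (r i) c = c := by
  change (z1Matrix m (r i) : Matrix (Fin 2) (Fin 2) ℂ).det • c = c
  rw [z1Matrix_r, rotMatrix, Matrix.det_fin_two_of]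
  have := Complex.cos_sq_add_sin_sq ((i.val * (2 * Real.pi / m) : ℝ) : ℂ)
  rw [← Complex.ofReal_cos, ← Complex.ofReal_sin] at this
  rw [mul_comm (-_), mul_neg, sub_neg_eq_add, ← sq, ← sq, this, one_smul]

theorem detRep_sr (i : ZMod m) (c : ℂ) : detRep m (sr i) c = -c := by
  change (z1Matrix m (sr i) : Matrix (Fin 2) (Fin 2) ℂ).det • c = -c
  rw [z1Matrix_sr, rotMatrix, Matrix.det_mul, Matrix.det_fin_two_of, Matrix.det_fin_two_of]
  have := Complex.cos_sq_add_sin_sq ((i.val * (2 * Real.pi / m) : ℝ) : ℂ)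
  rw [← Complex.ofReal_cos, ← Complex.ofReal_sin] at this
  rw [smul_eq_mul]
  linear_combination -c * this

theorem charHom_detRep_r (i : ZMod m) : charHom (r i) (repClass (detRep m)) = 1 := by
  rw [charHom_repClass, show detRep m (r i) = LinearMap.id from LinearMap.ext (detRep_r i)]
  simp

theorem charHom_detRep_sr (i : ZMod m) : charHom (sr i) (repClass (detRep m)) = -1 := by
  rw [charHom_repClass, show detRep m (sr i) = -LinearMap.id from LinearMap.ext (detRep_sr i)]
  simp

theorem charHom_z1_r (i : ZMod m) : charHom (r i) (repClass (z1 m)) =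
    stdAddChar i + stdAddChar (-i) := by
  rw [charHom_repClass]
  change LinearMap.trace ℂ _ (Matrix.toLin' (z1Matrix m (r i) : Matrix (Fin 2) (Fin 2) ℂ)) = _
  rw [Matrix.trace_toLin'_eq, z1Matrix_r, Matrix.trace_fin_two]
  have h1 : (stdAddChar i : ℂ) = Complex.exp (2 * Real.pi * Complex.I * i.val / m) := by
    rw [stdAddChar_apply, toCircle_apply]
  have h2 : (stdAddChar (-i) : ℂ) = Complex.exp (-(2 * Real.pi * Complex.I * i.val / m)) := by
    rw [AddChar.map_neg_eq_inv, h1, Complex.exp_neg]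
  rw [h1, h2]
  simp only [rotMatrix, Matrix.of_apply, Matrix.cons_val', Matrix.cons_val_zero,
    Matrix.cons_val_one, Matrix.cons_val_fin_one]
  rw [Complex.ofReal_cos, Complex.cos]
  push_cast
  ring_nf

theorem charHom_z1_sr (i : ZMod m) : charHom (sr i) (repClass (z1 m)) = 0 := by
  rw [charHom_repClass]
  change LinearMap.trace ℂ _ (Matrix.toLin' (z1Matrix m (sr i) : Matrix (Fin 2) (Fin 2) ℂ)) = _
  rw [Matrix.trace_toLin'_eq, z1Matrix_sr, Matrix.trace_fin_two]
  simp [rotMatrix]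

/-- The weights `1, …, ⌊(m - 1) / 2⌋`: one out of each pair `{k, -k}` with `k ≠ -k`. -/
def halfWeights (m : ℕ) [NeZero m] : Finset (ZMod m) :=
  Finset.univ.filter fun k => k ≠ 0 ∧ 2 * k.val < m

/-- The span of the classes of the trivial representation, of `det` and of the representations
`weightRep k` for one `k` out of each pair `{k, -k}`. For odd `m` these are the irreducible ones. -/
noncomputable def irredSpan (m : ℕ) [NeZero m] : AddSubgroup (RepRing (DihedralGroup m)) :=
  AddSubgroup.closure ({1, repClass (detRep m)} ∪
    {x | ∃ k ∈ halfWeights m, repClass (weightRep k) = x})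

theorem mem_irredSpan {x : RepRing (DihedralGroup m)} (hx : x ∈ irredSpan m) :
    ∃ (a b : ℤ) (c : ZMod m → ℤ), x = a • (1 : RepRing (DihedralGroup m)) +
      b • repClass (detRep m) + ∑ k ∈ halfWeights m, c k • repClass (weightRep k) := by
  induction hx using AddSubgroup.closure_induction with
  | mem x hx =>
    rcases hx with (rfl | rfl) | ⟨k, hk, rfl⟩
    · exact ⟨1, 0, 0, by simp⟩
    · exact ⟨0, 1, 0, by simp⟩
    · refine ⟨0, 0, Pi.single k 1, ?_⟩
      simp [Pi.single_apply, ite_smul, hk]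
  | zero => exact ⟨0, 0, 0, by simp⟩
  | add x y _ _ hx hy =>
    obtain ⟨a, b, c, rfl⟩ := hx
    obtain ⟨a', b', c', rfl⟩ := hy
    refine ⟨a + a', b + b', c + c', ?_⟩
    simp only [add_smul, Pi.add_apply, Finset.sum_add_distrib]
    abel
  | neg x _ hx =>
    obtain ⟨a, b, c, rfl⟩ := hx
    refine ⟨-a, -b, -c, ?_⟩
    simp only [neg_smul, Pi.neg_apply, Finset.sum_neg_distrib]
    abel

/-- Orthogonality of the characters of `ZMod m`, applied to the rotations, recovers the coefficients
of an element of the span of the irreducible classes from its character. -/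
theorem eq_zero_of_mem_irredSpan {x : RepRing (DihedralGroup m)} (hx : x ∈ irredSpan m)
    (h : ∀ g, charHom g x = 0) : x = 0 := by
  obtain ⟨a, b, c, rfl⟩ := mem_irredSpan hx
  have hr : ∀ i : ZMod m, (a + b + ∑ k ∈ halfWeights m,
      c k * (stdAddChar (k * i) + stdAddChar (-(k * i))) : ℂ) = 0 := by
    intro i
    have := h (r i)
    simpa [map_sum, charHom_detRep_r, charHom_weightRep_r] using this
  have hs : (a - b : ℂ) = 0 := by
    have := h (sr 0)
    simpa [map_sum, charHom_detRep_sr, charHom_weightRep_sr, ← sub_eq_add_neg] using this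
  have orth : ∀ k : ZMod m,
      ∑ i : ZMod m, (stdAddChar (k * i) : ℂ) = if k = 0 then (m : ℂ) else 0 := by
    intro k
    have := AddChar.sum_mulShift k (isPrimitive_stdAddChar m)
    rw [ZMod.card] at this
    simp only [mul_comm k, this]
    split_ifs <;> simp
  have hm : (m : ℂ) ≠ 0 := Nat.cast_ne_zero.2 (NeZero.ne m)
  have hc : ∀ l ∈ halfWeights m, c l = 0 := by
    intro l hl
    have hl' := (Finset.mem_filter.1 hl).2
    have e : ∑ i : ZMod m, stdAddChar (-l * i) * (a + b + ∑ k ∈ halfWeights m,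
        c k * (stdAddChar (k * i) + stdAddChar (-(k * i))) : ℂ) = 0 := by
      simp [hr]
    have e2 : ∀ i : ZMod m, stdAddChar (-l * i) * (a + b + ∑ k ∈ halfWeights m,
        c k * (stdAddChar (k * i) + stdAddChar (-(k * i))) : ℂ) =
        (a + b) * stdAddChar (-l * i) + ∑ k ∈ halfWeights m,
          c k * (stdAddChar ((k - l) * i) + stdAddChar ((-k - l) * i)) := by
      intro i
      rw [mul_add, mul_comm, Finset.mul_sum]
      congr 1
      refine Finset.sum_congr rfl fun k _ => ?_
      rw [show (k - l) * i = k * i + -l * i by ring, show (-k - l) * i = -(k * i) + -l * i by ring,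
        AddChar.map_add_eq_mul, AddChar.map_add_eq_mul]
      ring
    simp only [e2] at e
    rw [Finset.sum_add_distrib, ← Finset.mul_sum, orth, if_neg (neg_ne_zero.2 hl'.1), mul_zero,
      zero_add, Finset.sum_comm] at e
    simp only [← Finset.mul_sum, Finset.sum_add_distrib, orth] at e
    have e3 : ∀ k ∈ halfWeights m, (c k * ((if k - l = 0 then (m : ℂ) else 0) +
        if -k - l = 0 then (m : ℂ) else 0)) = if k = l then c l * (m : ℂ) else 0 := by
      intro k hk
      have hk' := (Finset.mem_filter.1 hk).2
      have : -k - l ≠ 0 := by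
        intro h0
        have h1 : -k = l := by rwa [sub_eq_zero] at h0
        have h2 := ZMod.neg_val k
        rw [if_neg hk'.1, h1] at h2
        have := ZMod.val_lt k
        omega
      rw [if_neg this, add_zero]
      by_cases hkl : k = l
      · simp [hkl]
      · simp [hkl, sub_eq_zero]
    rw [Finset.sum_congr rfl e3, Finset.sum_ite_eq' _ _ _, if_pos hl] at e
    exact_mod_cast (mul_eq_zero.1 e).resolve_right hm
  have hab : (a + b : ℂ) = 0 := by
    rw [← hr 0, Finset.sum_eq_zero, add_zero]
    intro k hk
    simp [hc k hk]
  have ha : a = 0 := by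
    have : (2 * a : ℂ) = 0 := by linear_combination hs + hab
    exact_mod_cast (mul_eq_zero.1 this).resolve_left two_ne_zero
  have hb : b = 0 := by
    have : (b : ℂ) = 0 := by rw [ha] at hab; simpa using hab
    exact_mod_cast this
  rw [Finset.sum_eq_zero (fun k hk => by rw [hc k hk, zero_smul]), ha, hb]
  simp

/-- An eigenvector `v` of `r` spans, together with `s v`, an image of the representation of the
corresponding weight. -/
theorem weightRep_intertwines {V : Type} [AddCommGroup V] [Module ℂ V]
    (ρ : Representation ℂ (DihedralGroup m) V) {k : ZMod m} {v : V}
    (hv : ∀ i, ρ (r i) v = (stdAddChar (k * i) : ℂ) • v) (g : DihedralGroup m) (w : Fin 2 → ℂ) :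
    weightRep k g w 0 • v + weightRep k g w 1 • ρ (sr 0) v =
      ρ g (w 0 • v + w 1 • ρ (sr 0) v) := by
  have hs : ∀ i, ρ (sr i) v = (stdAddChar (k * i) : ℂ) • ρ (sr 0) v := by
    intro i
    rw [← LinearMap.map_smul, ← hv, ← Module.End.mul_apply, ← map_mul, sr_mul_r, zero_add]
  have hrs : ∀ i, ρ (r i) (ρ (sr 0) v) = (stdAddChar (-(k * i)) : ℂ) • ρ (sr 0) v := by
    intro i
    rw [← Module.End.mul_apply, ← map_mul, r_mul_sr, hs]
    ring_nf
  have hss : ∀ i, ρ (sr i) (ρ (sr 0) v) = (stdAddChar (-(k * i)) : ℂ) • v := by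
    intro i
    rw [← Module.End.mul_apply, ← map_mul, sr_mul_sr, hv]
    ring_nf
  cases g with
  | r i =>
    rw [weightRep_r]
    simp [hv, hrs, smul_smul, mul_comm]
  | sr i =>
    rw [weightRep_sr]
    rw [map_add, LinearMap.map_smul, LinearMap.map_smul, hss, hs i, add_comm]
    simp [smul_smul, mul_comm]

/-- A nonzero vector fixed by `r` yields an invariant line on which `s` acts by `1` or `-1`. -/
theorem exists_line_of_fixed {V : Type} [AddCommGroup V] [Module ℂ V]
    (ρ : Representation ℂ (DihedralGroup m) V) {v : V} (hv0 : v ≠ 0) (hv : ∀ i, ρ (r i) v = v) :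
    ∃ u : V, u ≠ 0 ∧ ((∀ g (c : ℂ), (Representation.trivial ℂ (DihedralGroup m) ℂ g c) • u =
      ρ g (c • u)) ∨ (∀ g (c : ℂ), detRep m g c • u = ρ g (c • u))) := by
  have hs : ∀ i, ρ (sr i) v = ρ (sr 0) v := by
    intro i
    nth_rewrite 2 [← hv i]
    rw [← Module.End.mul_apply, ← map_mul, sr_mul_r, zero_add]
  have hrs : ∀ i, ρ (r i) (ρ (sr 0) v) = ρ (sr 0) v := by
    intro i
    rw [← Module.End.mul_apply, ← map_mul, r_mul_sr, hs]
  have hss : ∀ i, ρ (sr i) (ρ (sr 0) v) = v := by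
    intro i
    rw [← Module.End.mul_apply, ← map_mul, sr_mul_sr, hv]
  by_cases h : v + ρ (sr 0) v = 0
  · have h' : ρ (sr 0) v = -v := by rw [eq_neg_iff_add_eq_zero, add_comm, h]
    refine ⟨v, hv0, Or.inr ?_⟩
    rintro (i | i) c
    · rw [detRep_r, LinearMap.map_smul, hv]
    · rw [detRep_sr, LinearMap.map_smul, hs, h', smul_neg, neg_smul]
  · refine ⟨_, h, Or.inl ?_⟩
    rintro (i | i) c
    · simp [hv, hrs]
    · simp [hs, hss, add_comm]

theorem isPrimitiveRoot_stdAddChar_one : IsPrimitiveRoot (stdAddChar (1 : ZMod m) : ℂ) m := by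
  have := Complex.isPrimitiveRoot_exp m (NeZero.ne m)
  convert this using 1
  simpa using stdAddChar_coe (N := m) 1

theorem exists_eq_stdAddChar {μ : ℂ} (h : μ ^ m = 1) : ∃ k : ZMod m, μ = stdAddChar k := by
  have hp := isPrimitiveRoot_stdAddChar_one (m := m)
  obtain ⟨i, -, hi⟩ := hp.eq_pow_of_pow_eq_one h
  refine ⟨(i : ZMod m), ?_⟩
  rw [← hi, ← AddChar.map_nsmul_eq_pow, nsmul_one]

/-- The classes of the irreducible representations span: an eigenvector of `r` generates a copy of
one of them, which splits off. -/
theorem repClass_mem_irredSpan (hm : Odd m) (V : FDRep ℂ (DihedralGroup m)) :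
    repClass V.ρ ∈ irredSpan m := by
  induction hd : Module.finrank ℂ V using Nat.strong_induction_on generalizing V with
  | _ d ih =>
  rcases Nat.eq_zero_or_pos d with h0 | h0
  · have : Subsingleton V := Module.finrank_zero_iff.1 (hd.trans h0)
    rw [repClass_eq_zero]
    exact (irredSpan m).zero_mem
  -- It is enough to embed a nonzero representation whose class lies in the span.
  have step : ∀ {W : Type} [AddCommGroup W] [Module ℂ W] [Module.Finite ℂ W]
      (σ : Representation ℂ (DihedralGroup m) W) (f : W →ₗ[ℂ] V) (_ : Function.Injective f)
      (_ : ∀ g w, f (σ g w) = V.ρ g (f w)) (_ : 0 < Module.finrank ℂ W)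
      (_ : repClass σ ∈ irredSpan m), repClass V.ρ ∈ irredSpan m := by
    intro W _ _ _ σ f hf hfg hW hσ
    obtain ⟨τ, h1, h2⟩ := exists_repClass_eq_add f hf hfg
    rw [h1]
    exact (irredSpan m).add_mem hσ (ih _ (by omega) τ rfl)
  have : Nontrivial V := Module.nontrivial_of_finrank_pos (R := ℂ) (by omega)
  obtain ⟨μ, hμ⟩ := Module.End.exists_eigenvalue (V.ρ (r 1))
  obtain ⟨v, hv⟩ := hμ.exists_hasEigenvector
  have hpow : ∀ i : ℕ, V.ρ (r i) v = μ ^ i • v := by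
    intro i
    rw [← r_one_pow, map_pow]
    exact hv.pow_apply i
  have hμm : μ ^ m = 1 := by
    have := hpow m
    rw [ZMod.natCast_self, ← one_def, map_one, Module.End.one_apply] at this
    have h2 : (1 - μ ^ m) • v = 0 := by rw [sub_smul, one_smul, ← this, sub_self]
    exact (sub_eq_zero.1 ((smul_eq_zero.1 h2).resolve_right hv.2)).symm
  obtain ⟨k, rfl⟩ := exists_eq_stdAddChar hμm
  have hvr : ∀ i, V.ρ (r i) v = (stdAddChar (k * i) : ℂ) • v := by
    intro i
    have := hpow i.val
    rwa [ZMod.natCast_zmod_val, ← AddChar.map_nsmul_eq_pow, nsmul_eq_mul, ZMod.natCast_zmod_val,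
      mul_comm] at this
  by_cases hk : k = 0
  · obtain ⟨u, hu, h | h⟩ := exists_line_of_fixed V.ρ hv.2 (fun i => by simpa [hk] using hvr i)
    · refine step (Representation.trivial ℂ (DihedralGroup m) ℂ) (LinearMap.toSpanSingleton ℂ V u)
        (LinearMap.ker_eq_bot.1 (LinearMap.ker_toSpanSingleton ℂ hu)) h (by simp) ?_
      rw [repClass_trivial]
      exact AddSubgroup.subset_closure (Or.inl (Or.inl rfl))
    · refine step (detRep m) (LinearMap.toSpanSingleton ℂ V u)
        (LinearMap.ker_eq_bot.1 (LinearMap.ker_toSpanSingleton ℂ hu)) h (by simp) ?_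
      exact AddSubgroup.subset_closure (Or.inl (Or.inr rfl))
  · -- Since `m` is odd, the weights `k` and `-k` differ, and one of them is in the lower half.
    obtain ⟨l, u, hl, hu0, hu⟩ : ∃ (l : ZMod m) (u : V), l ∈ halfWeights m ∧ u ≠ 0 ∧
        ∀ i, V.ρ (r i) u = (stdAddChar (l * i) : ℂ) • u := by
      by_cases hkm : 2 * k.val < m
      · exact ⟨k, v, by simp [halfWeights, hk, hkm], hv.2, hvr⟩
      · refine ⟨-k, V.ρ (sr 0) v, ?_, ?_, ?_⟩
        · have h1 := ZMod.neg_val k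
          rw [if_neg hk] at h1
          obtain ⟨t, ht⟩ := hm
          simp only [halfWeights, Finset.mem_filter, Finset.mem_univ, true_and, ne_eq,
            neg_eq_zero, hk, not_false_eq_true, h1]
          omega
        · intro h
          apply hv.2
          have : V.ρ (sr 0) (V.ρ (sr 0) v) = v := by
            rw [← Module.End.mul_apply, ← map_mul, sr_mul_sr, sub_self, ← one_def, map_one,
              Module.End.one_apply]
          rw [← this, h, map_zero]
        · intro i
          rw [← Module.End.mul_apply, ← map_mul, r_mul_sr, show sr (0 - i) = sr 0 * r (-i) by
            rw [sr_mul_r, sub_eq_add_neg], map_mul, Module.End.mul_apply, hvr, LinearMap.map_smul]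
          ring_nf
    have hl0 := (Finset.mem_filter.1 hl).2
    have hint := weightRep_intertwines V.ρ hu
    let f : (Fin 2 → ℂ) →ₗ[ℂ] V :=
      (LinearMap.toSpanSingleton ℂ V u).comp (LinearMap.proj 0) +
        (LinearMap.toSpanSingleton ℂ V (V.ρ (sr 0) u)).comp (LinearMap.proj 1)
    refine step (weightRep l) f ?_ hint (by simp)
      (AddSubgroup.subset_closure (Or.inr ⟨l, hl, rfl⟩))
    rw [injective_iff_map_eq_zero]
    intro w hw
    have hw1 : w 0 • u + w 1 • V.ρ (sr 0) u = 0 := hw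
    have hw2 := hint (r 1) w
    rw [hw1, map_zero, weightRep_r] at hw2
    simp only [mul_one, Matrix.cons_val_zero, Matrix.cons_val_one, Matrix.cons_val_fin_one] at hw2
    have hne : (stdAddChar l : ℂ) ≠ stdAddChar (-l) := by
      intro h
      have h1 := congrArg ZMod.val (injective_stdAddChar h)
      rw [ZMod.neg_val, if_neg hl0.1] at h1
      omega
    -- Subtracting a multiple of one relation from the other isolates `w 0`.
    have hw3 : ((stdAddChar l - stdAddChar (-l) : ℂ) * w 0) • u = 0 := by
      have : ((stdAddChar l - stdAddChar (-l) : ℂ) * w 0) • u =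
          ((stdAddChar l * w 0 : ℂ) • u + (stdAddChar (-l) * w 1 : ℂ) • V.ρ (sr 0) u) -
          (stdAddChar (-l) : ℂ) • (w 0 • u + w 1 • V.ρ (sr 0) u) := by
        module
      rw [this, hw1, hw2, smul_zero, sub_zero]
    have hw0 : w 0 = 0 :=
      (mul_eq_zero.1 ((smul_eq_zero.1 hw3).resolve_right hu0)).resolve_left (sub_ne_zero.2 hne)
    have hsu : V.ρ (sr 0) u ≠ 0 := by
      intro h
      apply hu0
      have : V.ρ (sr 0) (V.ρ (sr 0) u) = u := by
        rw [← Module.End.mul_apply, ← map_mul, sr_mul_sr, sub_self, ← one_def, map_one,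
          Module.End.one_apply]
      rw [← this, h, map_zero]
    rw [hw0, zero_smul, zero_add] at hw1
    ext j
    fin_cases j
    · exact hw0
    · exact (smul_eq_zero.1 hw1).resolve_right hsu

/-- For odd `m`, an element of the representation ring of `I₂(m)` is determined by its
character. -/
theorem eq_of_charHom_eq (hm : Odd m) {x y : RepRing (DihedralGroup m)}
    (h : ∀ g, charHom g x = charHom g y) : x = y := by
  have htop := addSubgroup_eq_top_of_repClass_mem (irredSpan m) (repClass_mem_irredSpan hm)
  refine sub_eq_zero.1 (eq_zero_of_mem_irredSpan (htop ▸ AddSubgroup.mem_top _) fun g => ?_)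
  rw [map_sub, h, sub_self]

/-- All classes `weightRep k` lie in the subring, by the Chebyshev-type recursion in `k`. -/
theorem adjoin_z1_det (hm : Odd m) : Algebra.adjoin ℤ
    (Set.range ![repClass (z1 m), -repClass (detRep m)]) = ⊤ := by
  set A := Algebra.adjoin ℤ (Set.range ![repClass (z1 m), -repClass (detRep m)])
  have hz : repClass (z1 m) ∈ A := Algebra.subset_adjoin ⟨0, rfl⟩
  have hd : repClass (detRep m) ∈ A := by
    have : -repClass (detRep m) ∈ A := Algebra.subset_adjoin ⟨1, rfl⟩
    have h2 := A.neg_mem this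
    rwa [neg_neg] at h2
  have hw : ∀ k : ℕ, repClass (weightRep (k : ZMod m)) ∈ A := by
    intro k
    induction k using Nat.twoStepInduction with
    | zero =>
      have : repClass (weightRep ((0 : ℕ) : ZMod m)) = 1 + repClass (detRep m) := by
        apply eq_of_charHom_eq hm
        rintro (i | i)
        · simp [charHom_weightRep_r, charHom_detRep_r]
        · simp [charHom_weightRep_sr, charHom_detRep_sr]
      rw [this]
      exact A.add_mem A.one_mem hd
    | one =>
      have : repClass (weightRep ((1 : ℕ) : ZMod m)) = repClass (z1 m) := by
        apply eq_of_charHom_eq hm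
        rintro (i | i)
        · simp [charHom_weightRep_r, charHom_z1_r]
        · simp [charHom_weightRep_sr, charHom_z1_sr]
      rw [this]
      exact hz
    | more k ih0 ih1 =>
      have : repClass (weightRep ((k + 2 : ℕ) : ZMod m)) =
          repClass (z1 m) * repClass (weightRep ((k + 1 : ℕ) : ZMod m)) -
            repClass (weightRep (k : ZMod m)) := by
        apply eq_of_charHom_eq hm
        rintro (i | i)
        · rw [map_sub, map_mul, charHom_weightRep_r, charHom_weightRep_r, charHom_weightRep_r,
            charHom_z1_r]
          simp only [add_mul, mul_add, ← AddChar.map_add_eq_mul]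
          push_cast
          ring_nf
        · simp [charHom_weightRep_sr, charHom_z1_sr]
      rw [this]
      exact A.sub_mem (A.mul_mem hz ih1) ih0
  have htop := addSubgroup_eq_top_of_repClass_mem (irredSpan m) (repClass_mem_irredSpan hm)
  have hle : irredSpan m ≤ A.toSubring.toAddSubgroup := by
    rw [irredSpan, AddSubgroup.closure_le]
    rintro x ((rfl | rfl) | ⟨k, -, rfl⟩)
    · exact A.one_mem
    · exact hd
    · have := hw k.val
      rwa [ZMod.natCast_zmod_val] at this
  rw [eq_top_iff]
  rintro x -
  exact hle (htop ▸ AddSubgroup.mem_top x)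

end DihedralRep

/-! ### Fibonomial polynomials and their special values -/

section FibonomialPoly

open MvPolynomial

theorem fibPoly_zero : fibPoly 0 = 0 := by rw [fibPoly]

theorem fibPoly_one : fibPoly 1 = 1 := by rw [fibPoly]

theorem fibPoly_add_two (k : ℕ) :
    fibPoly (k + 2) = X 0 * fibPoly (k + 1) + X 1 * fibPoly k := by rw [fibPoly]

/-- The addition formula for generalized Fibonacci polynomials. -/
theorem fibPoly_add (a b : ℕ) :
    fibPoly (a + b + 1) = fibPoly (a + 1) * fibPoly (b + 1) + X 1 * fibPoly a * fibPoly b := by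
  induction a using Nat.twoStepInduction generalizing b with
  | zero => simp [fibPoly_zero, fibPoly_one]
  | one =>
    rw [show 1 + b + 1 = b + 2 by ring, fibPoly_add_two, fibPoly_add_two, fibPoly_zero,
      fibPoly_one]
    ring
  | more a ih0 ih1 =>
    rw [show a + 2 + b + 1 = (a + b + 1) + 2 by ring, fibPoly_add_two,
      show a + b + 1 + 1 = a + 1 + b + 1 by ring, ih0, ih1, fibPoly_add_two (a + 1),
      fibPoly_add_two a]
    ring

theorem fibFactorial_succ (n : ℕ) : fibFactorial (n + 1) = fibFactorial n * fibPoly (n + 1) :=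
  Finset.prod_range_succ _ _

theorem fibFactorial_zero : fibFactorial 0 = 1 := Finset.prod_range_zero _

theorem eval_fibPoly_two (k : ℕ) : aeval ![(2 : ℤ), -1] (fibPoly k) = k := by
  induction k using Nat.twoStepInduction with
  | zero => simp [fibPoly_zero]
  | one => simp [fibPoly_one]
  | more k ih0 ih1 =>
    rw [fibPoly_add_two, map_add, map_mul, map_mul, ih0, ih1]
    simp
    ring

theorem fibPoly_ne_zero {k : ℕ} (hk : k ≠ 0) : fibPoly k ≠ 0 := by
  intro h
  have := eval_fibPoly_two k
  rw [h, map_zero] at this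
  exact hk (by exact_mod_cast this.symm)

theorem fibFactorial_ne_zero (n : ℕ) : fibFactorial n ≠ 0 :=
  Finset.prod_ne_zero_iff.2 fun _ _ => fibPoly_ne_zero (Nat.succ_ne_zero _)

/-- The Fibonomial coefficients as polynomials, by their Pascal-type recursion. -/
noncomputable def fibonomialPoly : ℕ → ℕ → MvPolynomial (Fin 2) ℤ
  | _, 0 => 1
  | 0, _ + 1 => 0
  | n + 1, k + 1 => fibPoly (n - k + 1) * fibonomialPoly n k +
      X 1 * fibPoly k * fibonomialPoly n (k + 1)

theorem fibonomialPoly_eq_zero {n k : ℕ} (h : n < k) : fibonomialPoly n k = 0 := by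
  induction n generalizing k with
  | zero =>
    obtain ⟨k, rfl⟩ := Nat.exists_eq_succ_of_ne_zero h.ne'
    rw [fibonomialPoly]
  | succ n ih =>
    obtain ⟨k, rfl⟩ := Nat.exists_eq_succ_of_ne_zero (Nat.ne_zero_of_lt h)
    rw [Nat.succ_eq_add_one, fibonomialPoly, ih (by omega), ih (by omega)]
    ring

theorem fibonomialPoly_mul_fibFactorial (a k : ℕ) :
    fibonomialPoly (a + k) k * (fibFactorial k * fibFactorial a) = fibFactorial (a + k) := by
  induction k generalizing a with
  | zero => rw [fibonomialPoly, fibFactorial_zero, add_zero]; ring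
  | succ k ihk =>
    induction a with
    | zero =>
      rw [show 0 + (k + 1) = k + 1 by ring, fibonomialPoly, fibonomialPoly_eq_zero k.lt_succ_self,
        Nat.sub_self, fibPoly_one, fibFactorial_succ]
      have := ihk 0
      rw [zero_add, fibFactorial_zero] at this
      rw [fibFactorial_zero]
      linear_combination fibPoly (k + 1) * this
    | succ a iha =>
      have h1 := ihk (a + 1)
      have h2 := fibPoly_add (a + 1) k
      rw [show a + (k + 1) = a + 1 + k by ring] at iha
      rw [show a + 1 + (k + 1) = a + 1 + k + 1 by ring, fibonomialPoly,
        show a + 1 + k - k = a + 1 by omega, fibFactorial_succ (a + 1 + k), h2]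
      have e1 := fibFactorial_succ k
      have e2 := fibFactorial_succ a
      rw [e1] at iha ⊢
      rw [e2] at h1 ⊢
      linear_combination fibPoly (a + 1 + 1) * fibPoly (k + 1) * h1 +
        X 1 * fibPoly k * fibPoly (a + 1) * iha

/-- The Fibonomial Catalan number of index `m + 1` as a polynomial, a sum of two Fibonomial
coefficients. -/
noncomputable def fibCatalanPoly (m : ℕ) : MvPolynomial (Fin 2) ℤ :=
  fibonomialPoly (2 * m + 1) m + X 1 * if m = 0 then 0 else fibonomialPoly (2 * m + 1) (m - 1)

/-- The product formula, from `{2m + 2} = {m + 1} ({m + 2} + t {m})`. -/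
theorem fibCatalanPoly_mul (m : ℕ) :
    fibCatalanPoly m * (fibFactorial (m + 1) * fibFactorial (m + 2)) =
      fibFactorial (2 * m + 2) := by
  have hadd := fibPoly_add (m + 1) m
  rcases m with _ | m
  · simp [fibCatalanPoly, fibonomialPoly, fibFactorial_succ, fibFactorial_zero, fibPoly_one]
  · rw [fibCatalanPoly, if_neg m.succ_ne_zero, Nat.add_sub_cancel]
    have h1 := fibonomialPoly_mul_fibFactorial (m + 2) (m + 1)
    have h2 := fibonomialPoly_mul_fibFactorial (m + 3) m
    rw [show m + 2 + (m + 1) = 2 * (m + 1) + 1 by ring] at h1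
    rw [show m + 3 + m = 2 * (m + 1) + 1 by ring] at h2
    rw [fibFactorial_succ (2 * (m + 1) + 1),
      show 2 * (m + 1) + 1 + 1 = m + 1 + 1 + (m + 1) + 1 by ring, hadd]
    rw [fibFactorial_succ (m + 2), fibFactorial_succ (m + 1), fibFactorial_succ m] at h2 ⊢
    rw [fibFactorial_succ (m + 1), fibFactorial_succ m] at h1
    linear_combination fibPoly (m + 2) * fibPoly (m + 3) * h1 +
      X 1 * fibPoly (m + 1) * fibPoly (m + 2) * h2

theorem algebraMap_fibCatalanPoly (m : ℕ) :
    algebraMap (MvPolynomial (Fin 2) ℤ) (FractionRing (MvPolynomial (Fin 2) ℤ))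
      (fibCatalanPoly m) = fibCatalan (m + 1) := by
  have hinj := IsFractionRing.injective (MvPolynomial (Fin 2) ℤ)
    (FractionRing (MvPolynomial (Fin 2) ℤ))
  have h := congrArg (algebraMap (MvPolynomial (Fin 2) ℤ)
    (FractionRing (MvPolynomial (Fin 2) ℤ))) (fibCatalanPoly_mul m)
  have h1 := (map_ne_zero_iff _ hinj).2 (fibFactorial_ne_zero (m + 1))
  have h2 := (map_ne_zero_iff _ hinj).2 (fibPoly_ne_zero (m + 1).succ_ne_zero)
  rw [fibCatalan, fibonomial, show 2 * (m + 1) - (m + 1) = m + 1 by omega,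
    show 2 * (m + 1) = 2 * m + 2 by ring, ← h, fibFactorial_succ (m + 1)]
  simp only [map_mul]
  field_simp

/-! ### Values at points where the Fibonacci polynomials are periodic -/

/-- The quotient `{d k} / {d}`, as a polynomial. -/
noncomputable def fibRatio (d : ℕ) : ℕ → MvPolynomial (Fin 2) ℤ
  | 0 => 0
  | k + 1 => fibPoly (d * k + 1) + X 1 * fibPoly (d - 1) * fibRatio d k

theorem fibPoly_mul_eq (d : ℕ) (hd : 0 < d) (k : ℕ) :
    fibPoly (d * k) = fibRatio d k * fibPoly d := by
  induction k with
  | zero => simp [fibRatio, fibPoly_zero]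
  | succ k ih =>
    obtain ⟨e, rfl⟩ := Nat.exists_eq_succ_of_ne_zero hd.ne'
    have := fibPoly_add ((e + 1) * k) e
    rw [Nat.succ_eq_add_one, show (e + 1) * (k + 1) = (e + 1) * k + e + 1 by ring, this, fibRatio,
      Nat.add_sub_cancel]
    rw [Nat.succ_eq_add_one] at ih
    rw [ih]
    ring

/-- `{k}` with one factor `{d}` removed when `d` divides `k`. -/
noncomputable def fibReduced (d k : ℕ) : MvPolynomial (Fin 2) ℤ :=
  if d ∣ k then fibRatio d (k / d) else fibPoly k

theorem fibFactorial_eq_prod_fibReduced (d : ℕ) (hd : 0 < d) (n : ℕ) :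
    fibFactorial n = fibPoly d ^ (n / d) * ∏ i ∈ Finset.range n, fibReduced d (i + 1) := by
  induction n with
  | zero => simp [fibFactorial_zero]
  | succ n ih =>
    rw [fibFactorial_succ, ih, Finset.prod_range_succ, Nat.succ_div, fibReduced]
    split_ifs with h
    · obtain ⟨c, hc⟩ := h
      rw [hc, Nat.mul_div_cancel_left _ hd, fibPoly_mul_eq d hd, pow_succ]
      ring
    · ring

variable {R : Type*} [CommRing R]

/-- Value of the reduced factorial at a point `x` where `{k}` has period `d` in `k`. -/
theorem aeval_prod_fibReduced (x : Fin 2 → R) (d : ℕ) (hd : 0 < d)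
    (hper : ∀ k, aeval x (fibPoly (k + d)) = aeval x (fibPoly k))
    (hratio : ∀ k, aeval x (fibRatio d k) = k) (a b : ℕ) (hb : b < d) :
    aeval x (∏ i ∈ Finset.range (d * a + b), fibReduced d (i + 1)) =
      (a.factorial : R) * (∏ i ∈ Finset.range (d - 1), aeval x (fibPoly (i + 1))) ^ a *
        ∏ i ∈ Finset.range b, aeval x (fibPoly (i + 1)) := by
  have hper' : ∀ a k, aeval x (fibPoly (d * a + k)) = aeval x (fibPoly k) := by
    intro a k
    induction a with
    | zero => rw [mul_zero, zero_add]
    | succ a ih => rw [show d * (a + 1) + k = d * a + k + d by ring, hper, ih]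
  have hpart : ∀ a b, b < d → aeval x (∏ i ∈ Finset.range b, fibReduced d (d * a + i + 1)) =
      ∏ i ∈ Finset.range b, aeval x (fibPoly (i + 1)) := by
    intro a b hb
    rw [map_prod]
    refine Finset.prod_congr rfl fun i hi => ?_
    have hi := Finset.mem_range.1 hi
    have : ¬ d ∣ d * a + i + 1 := by
      rw [add_assoc, Nat.dvd_add_right (Dvd.intro _ rfl)]
      exact Nat.not_dvd_of_pos_of_lt (by omega) (by omega)
    rw [fibReduced, if_neg this, add_assoc, hper']
  rw [Finset.prod_range_add, map_mul, hpart a b hb]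
  congr 1
  induction a with
  | zero => simp
  | succ a ih =>
    rw [show d * (a + 1) = d * a + (d - 1 + 1) by rw [Nat.sub_add_cancel hd]; ring,
      Finset.prod_range_add, Finset.prod_range_succ, map_mul, map_mul, ih,
      hpart a (d - 1) (by omega), show d * a + (d - 1) + 1 = d * (a + 1) by
        rw [add_assoc, Nat.sub_add_cancel hd]; ring,
      fibReduced, if_pos (Dvd.intro _ rfl), Nat.mul_div_cancel_left _ hd, hratio,
      Nat.factorial_succ, pow_succ]
    push_cast
    ring

/-- The product formula for the Catalan polynomial without the factors `{d}`, which cancel when they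
are equally many above and below; it can be evaluated where `{d}` vanishes. -/
theorem aeval_fibCatalanPoly_mul (x : Fin 2 → R) (d : ℕ) (hd : 0 < d) (m : ℕ)
    (h : (m + 1) / d + (m + 2) / d = (2 * m + 2) / d) :
    aeval x (fibCatalanPoly m) *
      (aeval x (∏ i ∈ Finset.range (m + 1), fibReduced d (i + 1)) *
        aeval x (∏ i ∈ Finset.range (m + 2), fibReduced d (i + 1))) =
      aeval x (∏ i ∈ Finset.range (2 * m + 2), fibReduced d (i + 1)) := by
  rw [← map_mul, ← map_mul]
  congr 1
  have := fibCatalanPoly_mul m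
  rw [fibFactorial_eq_prod_fibReduced d hd, fibFactorial_eq_prod_fibReduced d hd,
    fibFactorial_eq_prod_fibReduced d hd, ← h, pow_add] at this
  refine mul_left_cancel₀ (mul_ne_zero (pow_ne_zero ((m + 1) / d) (fibPoly_ne_zero hd.ne'))
    (pow_ne_zero ((m + 2) / d) (fibPoly_ne_zero hd.ne'))) ?_
  linear_combination this

theorem aeval_fibPoly_add_two (a b : R) (k : ℕ) : aeval ![a, b] (fibPoly (k + 2)) =
    a * aeval ![a, b] (fibPoly (k + 1)) + b * aeval ![a, b] (fibPoly k) := by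
  simp [fibPoly_add_two]

theorem aeval_fibRatio_succ (a b : R) (d k : ℕ) : aeval ![a, b] (fibRatio d (k + 1)) =
    aeval ![a, b] (fibPoly (d * k + 1)) +
      b * aeval ![a, b] (fibPoly (d - 1)) * aeval ![a, b] (fibRatio d k) := by
  simp [fibRatio]

theorem aeval_fibPoly_periodic (x : Fin 2 → R) (d : ℕ)
    (hper : ∀ k, aeval x (fibPoly (k + d)) = aeval x (fibPoly k)) (a k : ℕ) :
    aeval x (fibPoly (d * a + k)) = aeval x (fibPoly k) := by
  induction a with
  | zero => rw [mul_zero, zero_add]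
  | succ a ih => rw [show d * (a + 1) + k = d * a + k + d by ring, hper, ih]

/-- The value of the Catalan polynomial at `(2, -1)` is the ordinary Catalan number. -/
theorem aeval_fibCatalanPoly_two (m : ℕ) :
    aeval ![(2 : ℂ), -1] (fibCatalanPoly m) * ((m + 1).factorial * (m + 2).factorial) =
      (2 * m + 2).factorial := by
  have hk : ∀ k, aeval ![(2 : ℂ), -1] (fibPoly k) = k := by
    intro k
    induction k using Nat.twoStepInduction with
    | zero => simp [fibPoly_zero]
    | one => simp [fibPoly_one]
    | more k ih0 ih1 =>
      rw [aeval_fibPoly_add_two, ih0, ih1]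
      push_cast
      ring
  have hf : ∀ n, aeval ![(2 : ℂ), -1] (fibFactorial n) = n.factorial := by
    intro n
    induction n with
    | zero => simp [fibFactorial_zero]
    | succ n ih =>
      rw [fibFactorial_succ, map_mul, ih, hk, Nat.factorial_succ]
      push_cast
      ring
  have := congrArg (aeval ![(2 : ℂ), -1]) (fibCatalanPoly_mul m)
  simpa only [map_mul, hf] using this

theorem eq_choose_of_mul_factorial {x : ℂ} {e : ℕ}
    (h : x * (e.factorial * e.factorial) = (2 * e).factorial) : x = (2 * e).choose e := by
  have h1 : ((2 * e).choose e * e.factorial * e.factorial : ℂ) = (2 * e).factorial := by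
    have := Nat.choose_mul_factorial_mul_factorial (show e ≤ 2 * e by omega)
    rw [show 2 * e - e = e by omega] at this
    exact_mod_cast this
  have h2 : (e.factorial : ℂ) ≠ 0 := Nat.cast_ne_zero.2 e.factorial_ne_zero
  apply mul_right_cancel₀ (mul_ne_zero h2 h2)
  rw [h, ← h1, mul_assoc]

/-- The value of the Catalan polynomial at `(0, 1)`, where `{k}` has period two. -/
theorem aeval_fibCatalanPoly_zero_one (m p : ℕ) (hm : m + 1 = 2 * p) :
    aeval ![(0 : ℂ), 1] (fibCatalanPoly m) = (2 * p).choose p := by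
  have hper : ∀ k, aeval ![(0 : ℂ), 1] (fibPoly (k + 2)) = aeval ![(0 : ℂ), 1] (fibPoly k) := by
    intro k
    rw [aeval_fibPoly_add_two]
    ring
  have hratio : ∀ k, aeval ![(0 : ℂ), 1] (fibRatio 2 k) = k := by
    intro k
    induction k with
    | zero => simp [fibRatio]
    | succ k ih =>
      rw [aeval_fibRatio_succ, ih, aeval_fibPoly_periodic _ _ hper]
      simp [fibPoly_one, add_comm]
  have h := aeval_fibCatalanPoly_mul ![(0 : ℂ), 1] 2 two_pos m (by omega)
  have e1 := aeval_prod_fibReduced ![(0 : ℂ), 1] 2 two_pos hper hratio p 0 two_pos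
  have e2 := aeval_prod_fibReduced ![(0 : ℂ), 1] 2 two_pos hper hratio p 1 one_lt_two
  have e3 := aeval_prod_fibReduced ![(0 : ℂ), 1] 2 two_pos hper hratio (2 * p) 0 two_pos
  rw [show m + 1 = 2 * p + 0 by omega, show m + 2 = 2 * p + 1 by omega,
    show 2 * m + 2 = 2 * (2 * p) + 0 by omega, e1, e2, e3] at h
  apply eq_choose_of_mul_factorial
  simpa [fibPoly_one] using h

/-- The value of the Catalan polynomial at `(ω + ω⁻¹, -1)` for a primitive `d`-th root of unity `ω`
of odd order `d ≥ 3`. -/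
theorem aeval_fibCatalanPoly_root {ω : ℂ} {d : ℕ} (hω : IsPrimitiveRoot ω d) (hd : Odd d)
    (hd3 : 3 ≤ d) (e : ℕ) :
    aeval ![ω + ω⁻¹, -1] (fibCatalanPoly (d * e)) = (2 * e).choose e := by
  have hω0 : ω ≠ 0 := hω.ne_zero (by omega)
  have hne : ∀ k, 0 < k → k < d → ω ^ k - ω⁻¹ ^ k ≠ 0 := by
    intro k hk hkd h
    have h1 : ω ^ (2 * k) = 1 := by
      rw [two_mul, pow_add]
      nth_rewrite 1 [sub_eq_zero.1 h]
      rw [← mul_pow, inv_mul_cancel₀ hω0, one_pow]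
    have h2 := (Nat.Coprime.dvd_mul_left (Nat.coprime_two_right.2 hd)).1 (hω.dvd_of_pow_eq_one _ h1)
    exact Nat.not_dvd_of_pos_of_lt hk hkd h2
  have h1ne := hne 1 one_pos (by omega)
  rw [pow_one, pow_one] at h1ne
  have hclosed : ∀ k, (ω - ω⁻¹) * aeval ![ω + ω⁻¹, -1] (fibPoly k) = ω ^ k - ω⁻¹ ^ k := by
    intro k
    induction k using Nat.twoStepInduction with
    | zero => simp [fibPoly_zero]
    | one => simp [fibPoly_one]
    | more k ih0 ih1 =>
      rw [aeval_fibPoly_add_two]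
      have : ω * ω⁻¹ = 1 := mul_inv_cancel₀ hω0
      linear_combination (ω + ω⁻¹) * ih1 - ih0 + (ω ^ k - ω⁻¹ ^ k) * this
  have hnz : ∀ k, 0 < k → k < d → aeval ![ω + ω⁻¹, -1] (fibPoly k) ≠ 0 := by
    intro k hk hkd h
    have := hclosed k
    rw [h, mul_zero] at this
    exact hne k hk hkd this.symm
  have hωd : ω ^ d = 1 := hω.pow_eq_one
  have hper : ∀ k, aeval ![ω + ω⁻¹, -1] (fibPoly (k + d)) =
      aeval ![ω + ω⁻¹, -1] (fibPoly k) := by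
    intro k
    apply mul_left_cancel₀ h1ne
    rw [hclosed, hclosed, pow_add, pow_add, inv_pow _ d, hωd, inv_one, mul_one, mul_one]
  have hlast : aeval ![ω + ω⁻¹, -1] (fibPoly (d - 1)) = -1 := by
    have := aeval_fibPoly_add_two (ω + ω⁻¹) (-1) (d - 1)
    rw [show d - 1 + 2 = 1 + d by omega, show d - 1 + 1 = 0 + d by omega, hper, hper, fibPoly_zero,
      fibPoly_one, map_zero, map_one] at this
    linear_combination this
  have hratio : ∀ k, aeval ![ω + ω⁻¹, -1] (fibRatio d k) = k := by
    intro k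
    induction k with
    | zero => simp [fibRatio]
    | succ k ih =>
      rw [aeval_fibRatio_succ, ih, aeval_fibPoly_periodic _ _ hper, hlast]
      simp [fibPoly_one, add_comm]
  have hd0 : 0 < d := by omega
  have h := aeval_fibCatalanPoly_mul ![ω + ω⁻¹, -1] d hd0 (d * e) (by
    rw [show 2 * (d * e) + 2 = d * (2 * e) + 2 by ring, Nat.mul_add_div hd0, Nat.mul_add_div hd0,
      Nat.mul_add_div hd0, Nat.div_eq_of_lt (show 1 < d by omega),
      Nat.div_eq_of_lt (show 2 < d by omega)]
    ring)
  have hv := aeval_prod_fibReduced ![ω + ω⁻¹, -1] d hd0 hper hratio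
  rw [hv e 1 (by omega), hv e 2 (by omega), show 2 * (d * e) + 2 = d * (2 * e) + 2 by ring,
    hv (2 * e) 2 (by omega), show 2 * e = e + e by ring, pow_add] at h
  apply eq_choose_of_mul_factorial
  rw [show 2 * e = e + e by ring]
  have hA : (∏ i ∈ Finset.range (d - 1), aeval ![ω + ω⁻¹, -1] (fibPoly (i + 1))) ≠ 0 :=
    Finset.prod_ne_zero_iff.2 fun i hi => hnz _ (by omega) (by
      have := Finset.mem_range.1 hi
      omega)
  have hB : (∏ i ∈ Finset.range 2, aeval ![ω + ω⁻¹, -1] (fibPoly (i + 1))) ≠ 0 :=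
    Finset.prod_ne_zero_iff.2 fun i hi => hnz _ (by omega) (by
      have := Finset.mem_range.1 hi
      omega)
  have hone : (∏ i ∈ Finset.range 1, aeval ![ω + ω⁻¹, -1] (fibPoly (i + 1))) = 1 := by
    simp [fibPoly_one]
  rw [hone] at h
  have hAe := pow_ne_zero e hA
  apply mul_right_cancel₀ (mul_ne_zero (mul_ne_zero hAe hAe) hB)
  linear_combination h

end FibonomialPoly

/-! ### Noncrossing involutions -/

section NCInvolution

/-- A noncrossing involution of a linear order: the arcs `{i, f i}` with `f i ≠ i` do not cross. -/
structure IsNCInvolution {α : Type*} [LinearOrder α] (f : α → α) : Prop where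
  invol : ∀ i, f (f i) = i
  noncrossing : ∀ i j, i < j → j < f i → ¬ f i < f j

variable {α : Type*} [LinearOrder α]

/-- An arc with an endpoint under another arc lies entirely under it. -/
theorem IsNCInvolution.between {f : α → α} (hf : IsNCInvolution f) {i j : α} (h1 : i < j)
    (h2 : j < f i) : i < f j ∧ f j < f i := by
  constructor
  · rcases lt_trichotomy i (f j) with h | h | h
    · exact h
    · rw [h, hf.invol] at h2
      exact absurd h2 (lt_irrefl _)
    · exact absurd h2 (hf.noncrossing (f j) i h (by rwa [hf.invol]) ∘ by rw [hf.invol]; exact id)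
  · rcases lt_trichotomy (f j) (f i) with h | h | h
    · exact h
    · have := congrArg f h
      rw [hf.invol, hf.invol] at this
      exact absurd this h1.ne'
    · exact absurd h (hf.noncrossing i j h1 h2)

/-- A noncrossing involution is determined by its sets of left and right endpoints: at a shortest
arc where two of them differ, the partner of its right endpoint gives a shorter one. -/
theorem IsNCInvolution.eq_of_lt_iff [LocallyFiniteOrder α] {f g : α → α} (hf : IsNCInvolution f)
    (hg : IsNCInvolution g) (h1 : ∀ i, i < f i ↔ i < g i) (h2 : ∀ i, f i < i ↔ g i < i) :
    f = g := by
  have key : ∀ (d : ℕ) (f g : α → α), IsNCInvolution f → IsNCInvolution g →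
      (∀ i, i < f i ↔ i < g i) → (∀ i, f i < i ↔ g i < i) →
      ∀ i, i < f i → (Finset.Icc i (f i)).card = d → f i = g i := by
    intro d
    induction d using Nat.strong_induction_on with
    | _ d ih =>
    intro f g hf hg h1 h2 i hi hd
    rcases lt_trichotomy (f i) (g i) with h | h | h
    · exfalso
      have h3 : g (f i) < f i := (h2 _).1 (by rwa [hf.invol])
      have h4 := (hg.between hi h).1
      have h5 : f i = f (g (f i)) := by
        have := ih (Finset.Icc (g (f i)) (f i)).card (by
          rw [← hd]
          apply Finset.card_lt_card
          rw [Finset.ssubset_iff_of_subset (Finset.Icc_subset_Icc_left h4.le)]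
          exact ⟨i, by simp [hi.le], by simp [h4]⟩) g f hg hf (fun i => (h1 i).symm)
          (fun i => (h2 i).symm) (g (f i)) (by rwa [hg.invol]) (by rw [hg.invol])
        rwa [hg.invol] at this
      have h6 := congrArg f h5
      rw [hf.invol, hf.invol] at h6
      exact h4.ne h6
    · exact h
    · have h3 : i < g i := (h1 i).1 hi
      exact (ih (Finset.Icc i (g i)).card (by
        rw [← hd]
        apply Finset.card_lt_card
        rw [Finset.ssubset_iff_of_subset (Finset.Icc_subset_Icc_right h.le)]
        exact ⟨f i, by simp [hi.le], by simp [h]⟩) g f hg hf (fun i => (h1 i).symm)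
          (fun i => (h2 i).symm) i h3 rfl).symm
  ext i
  rcases lt_trichotomy i (f i) with h | h | h
  · exact key _ f g hf hg h1 h2 i h rfl
  · have h3 : ¬ i < g i := fun h' => h.not_lt ((h1 i).2 h')
    have h4 : ¬ g i < i := fun h' => h.not_gt ((h2 i).2 h')
    rw [← h]
    exact le_antisymm (not_lt.1 h4) (not_lt.1 h3)
  · have h5 := key _ f g hf hg h1 h2 (f i) (by rwa [hf.invol]) rfl
    rw [hf.invol] at h5
    rw [h5, hg.invol, ← h5]

/-- `i < j` are matched by the height function `h`: the excursion above level `h i` that starts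
with the step at `i` ends with the step at `j`. -/
def Matched (h : ℤ → ℤ) (i j : ℤ) : Prop :=
  i < j ∧ h (j + 1) ≤ h i ∧ ∀ k, i < k → k ≤ j → h i < h k

/-- A height function with steps in `{-1, 0, 1}`, each of whose up-steps is eventually undone to
the right and each of whose down-steps is eventually undone to the left, comes from a noncrossing
involution. -/
theorem exists_isNCInvolution (h : ℤ → ℤ) (hup : ∀ i, h (i + 1) ≤ h i + 1)
    (hdown : ∀ i, h i - 1 ≤ h (i + 1))
    (hr : ∀ i, h i < h (i + 1) → ∃ j, i < j ∧ h (j + 1) ≤ h i)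
    (hl : ∀ j, h (j + 1) < h j → ∃ i, i < j ∧ h i ≤ h (j + 1)) :
    ∃ f : ℤ → ℤ, IsNCInvolution f ∧ (∀ i, i < f i ↔ h i < h (i + 1)) ∧
      ∀ i, f i < i ↔ h (i + 1) < h i := by
  have exr : ∀ i, h i < h (i + 1) → ∃ j, Matched h i j := by
    intro i hi
    obtain ⟨j, ⟨hj1, hj2⟩, hmin⟩ := Int.exists_least_of_bdd
      (P := fun j => i < j ∧ h (j + 1) ≤ h i) ⟨i, fun z hz => hz.1.le⟩ (hr i hi)
    refine ⟨j, hj1, hj2, fun k hk1 hk2 => ?_⟩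
    rcases eq_or_lt_of_le (show i + 1 ≤ k by omega) with e | e
    · rwa [← e]
    · by_contra hc
      have := hmin (k - 1) ⟨by omega, by rw [sub_add_cancel]; omega⟩
      omega
  have exl : ∀ j, h (j + 1) < h j → ∃ i, Matched h i j := by
    intro j hj
    obtain ⟨i, ⟨hi1, hi2⟩, hmax⟩ := Int.exists_greatest_of_bdd
      (P := fun i => i < j ∧ h i ≤ h (j + 1)) ⟨j, fun z hz => hz.1.le⟩ (hl j hj)
    have hlt : ∀ k, i < k → k ≤ j → h (j + 1) < h k := by
      intro k hk1 hk2
      rcases eq_or_lt_of_le hk2 with e | e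
      · rwa [e]
      · by_contra hc
        have := hmax k ⟨e, by omega⟩
        omega
    refine ⟨i, hi1, ?_, fun k hk1 hk2 => lt_of_le_of_lt hi2 (hlt k hk1 hk2)⟩
    have h1 := hlt (i + 1) (by omega) (by omega)
    have h2 := hup i
    omega
  have mup : ∀ i j, Matched h i j → h i < h (i + 1) := fun i j hM => hM.2.2 _ (by omega)
    (by have := hM.1; omega)
  have mdown : ∀ i j, Matched h i j → h (j + 1) < h j := fun i j hM =>
    lt_of_le_of_lt hM.2.1 (hM.2.2 j hM.1 le_rfl)
  have uniqr : ∀ i j j', Matched h i j → Matched h i j' → j = j' := by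
    intro i
    have : ∀ j j', Matched h i j → Matched h i j' → ¬ j < j' := by
      intro j j' h1 h2 hlt
      have h3 := h2.2.2 (j + 1) (by have := h1.1; omega) (by omega)
      have h4 := h1.2.1
      omega
    intro j j' h1 h2
    exact le_antisymm (not_lt.1 (this _ _ h2 h1)) (not_lt.1 (this _ _ h1 h2))
  have uniql : ∀ i i' j, Matched h i j → Matched h i' j → i = i' := by
    have : ∀ i i' j, Matched h i j → Matched h i' j → ¬ i < i' := by
      intro i i' j h1 h2 hlt
      have h3 := h1.2.2 i' hlt h2.1.le
      have h4 := h1.2.1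
      have h5 := h2.2.2 j h2.1 le_rfl
      have h6 := hdown j
      omega
    intro i i' j h1 h2
    exact le_antisymm (not_lt.1 (this _ _ _ h2 h1)) (not_lt.1 (this _ _ _ h1 h2))
  let R : ℤ → ℤ → Prop := fun i j => Matched h i j ∨ Matched h j i ∨ (j = i ∧ h (i + 1) = h i)
  have Rex : ∀ i, ∃ j, R i j := by
    intro i
    rcases lt_trichotomy (h i) (h (i + 1)) with e | e | e
    · obtain ⟨j, hj⟩ := exr i e
      exact ⟨j, Or.inl hj⟩
    · exact ⟨i, Or.inr (Or.inr ⟨rfl, e.symm⟩)⟩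
    · obtain ⟨j, hj⟩ := exl i e
      exact ⟨j, Or.inr (Or.inl hj)⟩
  have Rsymm : ∀ i j, R i j → R j i := by
    rintro i j (hM | hM | ⟨rfl, e⟩)
    · exact Or.inr (Or.inl hM)
    · exact Or.inl hM
    · exact Or.inr (Or.inr ⟨rfl, e⟩)
  have Runiq : ∀ i j j', R i j → R i j' → j = j' := by
    rintro i j j' (h1 | h1 | ⟨rfl, e1⟩) (h2 | h2 | ⟨rfl, e2⟩)
    · exact uniqr _ _ _ h1 h2
    · exact absurd (mdown _ _ h2) (mup _ _ h1).not_gt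
    · exact absurd e2 (mup _ _ h1).ne'
    · exact absurd (mdown _ _ h1) (mup _ _ h2).not_gt
    · exact uniql _ _ _ h1 h2
    · exact absurd e2 (mdown _ _ h1).ne
    · exact absurd e1 (mup _ _ h2).ne'
    · exact absurd e1 (mdown _ _ h2).ne
    · rfl
  choose f hf using Rex
  have hMf : ∀ i, i < f i → Matched h i (f i) := by
    intro i hi
    rcases hf i with h1 | h1 | h1
    · exact h1
    · exact absurd h1.1 hi.not_gt
    · exact absurd h1.1 hi.ne'
  refine ⟨f, ⟨fun i => Runiq _ _ _ (hf (f i)) (Rsymm _ _ (hf i)), ?_⟩, fun i => ?_, fun i => ?_⟩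
  · intro i j h1 h2 h3
    have hi := hMf i (h1.trans h2)
    have hj := hMf j (h2.trans h3)
    have e1 := hi.2.2 j h1 h2.le
    have e2 := hj.2.2 (f i + 1) (by omega) (by omega)
    have e3 := hi.2.1
    omega
  · constructor
    · intro hi
      exact mup _ _ (hMf i hi)
    · intro hi
      rcases hf i with h1 | h1 | h1
      · exact h1.1
      · exact absurd (mdown _ _ h1) hi.not_gt
      · exact absurd h1.2 hi.ne'
  · constructor
    · intro hi
      rcases hf i with h1 | h1 | h1
      · exact absurd h1.1 hi.not_gt
      · exact mdown _ _ h1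
      · exact absurd h1.1 hi.ne
    · intro hi
      rcases hf i with h1 | h1 | h1
      · exact absurd (mup _ _ h1) hi.not_gt
      · exact h1.1
      · exact absurd h1.2 hi.ne

end NCInvolution

/-! ### Configurations as decorated involutions -/

section Partner

variable {m : ℕ}

open Classical in
/-- The other endpoint of the arc at `i`, or `i` itself if there is no such arc. -/
noncomputable def partner (x : Finset (Finset (Fin m))) (i : Fin m) : Fin m :=
  if h : ∃ j, j ≠ i ∧ ({i, j} : Finset (Fin m)) ∈ x then h.choose else i

theorem IsNCConfig.eq_of_pair_mem {x : Finset (Finset (Fin m))} (hx : IsNCConfig x) {i j k : Fin m}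
    (hj : j ≠ i) (h1 : ({i, j} : Finset (Fin m)) ∈ x) (h2 : ({i, k} : Finset (Fin m)) ∈ x) :
    k = j := by
  by_contra hne
  have hd := hx.disjoint _ h1 _ h2 (by
    intro e
    have : j ∈ ({i, k} : Finset (Fin m)) := by rw [← e]; simp
    simp only [Finset.mem_insert, Finset.mem_singleton] at this
    rcases this with h | h
    · exact hj h
    · exact hne h.symm)
  exact Finset.disjoint_left.1 hd (Finset.mem_insert_self _ _) (Finset.mem_insert_self _ _)

theorem IsNCConfig.partner_eq_iff {x : Finset (Finset (Fin m))} (hx : IsNCConfig x) {i j : Fin m}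
    (hj : j ≠ i) : partner x i = j ↔ ({i, j} : Finset (Fin m)) ∈ x := by
  rw [partner]
  split_ifs with h
  · have hs := h.choose_spec
    constructor
    · intro e
      rw [← e]
      exact hs.2
    · intro h2
      exact hx.eq_of_pair_mem hj h2 hs.2
  · constructor
    · intro e
      exact absurd e.symm hj
    · intro h2
      exact absurd ⟨j, hj, h2⟩ h

theorem IsNCConfig.partner_partner {x : Finset (Finset (Fin m))} (hx : IsNCConfig x) (i : Fin m) :
    partner x (partner x i) = i := by
  by_cases h : partner x i = i
  · rw [h, h]
  · rw [hx.partner_eq_iff (Ne.symm h), Finset.pair_comm, ← hx.partner_eq_iff h]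

theorem IsNCConfig.isNCInvolution {x : Finset (Finset (Fin m))} (hx : IsNCConfig x) :
    IsNCInvolution (partner x) where
  invol := hx.partner_partner
  noncrossing i j h1 h2 h3 := hx.noncrossing ⟨i, j, partner x i, partner x j, h1, h2, h3,
    (hx.partner_eq_iff (h1.trans h2).ne').1 rfl, (hx.partner_eq_iff (h2.trans h3).ne').1 rfl⟩

theorem IsNCConfig.partner_of_ball {x : Finset (Finset (Fin m))} (hx : IsNCConfig x) {i : Fin m}
    (hi : {i} ∈ x) : partner x i = i := by
  by_contra h
  refine h (hx.eq_of_pair_mem h ((hx.partner_eq_iff h).1 rfl) (k := i) ?_).symm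
  simpa using hi

theorem IsNCConfig.subset_of_partner {x y : Finset (Finset (Fin m))} (hx : IsNCConfig x)
    (hy : IsNCConfig y) (h1 : ∀ i, partner x i = partner y i)
    (h2 : ∀ i, ({i} : Finset (Fin m)) ∈ x ↔ {i} ∈ y) : x ⊆ y := by
  intro b hb
  rcases hx.card_block b hb with h | h
  · obtain ⟨i, rfl⟩ := Finset.card_eq_one.1 h
    exact (h2 i).1 hb
  · obtain ⟨i, j, hij, rfl⟩ := Finset.card_eq_two.1 h
    rw [← hx.partner_eq_iff hij.symm] at hb
    rw [← hy.partner_eq_iff hij.symm, ← h1, hb]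

theorem IsNCConfig.eq_of_partner {x y : Finset (Finset (Fin m))} (hx : IsNCConfig x)
    (hy : IsNCConfig y) (h1 : ∀ i, partner x i = partner y i)
    (h2 : ∀ i, ({i} : Finset (Fin m)) ∈ x ↔ {i} ∈ y) : x = y :=
  (hx.subset_of_partner hy h1 h2).antisymm
    (hy.subset_of_partner hx (fun i => (h1 i).symm) fun i => (h2 i).symm)

theorem ball_mem_mapBlocks (σ : Equiv.Perm (Fin m)) (x : Finset (Finset (Fin m))) (i : Fin m) :
    ({σ i} : Finset (Fin m)) ∈ mapBlocks σ x ↔ {i} ∈ x := by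
  have := pair_mem_mapBlocks σ x (σ i) (σ i)
  simpa using this

theorem IsNCConfig.partner_mapBlocks {x : Finset (Finset (Fin m))} (hx : IsNCConfig x)
    (σ : Equiv.Perm (Fin m)) (hσ : IsNCConfig (mapBlocks σ x)) (i : Fin m) :
    partner (mapBlocks σ x) (σ i) = σ (partner x i) := by
  by_cases h : partner x i = i
  · rw [h]
    by_contra hne
    have h1 := (hσ.partner_eq_iff hne).1 rfl
    rw [pair_mem_mapBlocks, Equiv.symm_apply_apply, ← hx.partner_eq_iff, h] at h1
    · exact hne ((Equiv.symm_apply_eq σ).1 h1.symm)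
    · intro e
      rw [Equiv.symm_apply_eq] at e
      exact hne e
  · rw [hσ.partner_eq_iff (fun e => h (σ.injective e)), pair_mem_mapBlocks, Equiv.symm_apply_apply,
      Equiv.symm_apply_apply, ← hx.partner_eq_iff h]

open Classical in
/-- The configuration with arcs `{i, p i}` and balls at the points where `B` holds. -/
noncomputable def configOf (p : Fin m → Fin m) (B : Fin m → Prop) : Finset (Finset (Fin m)) :=
  Finset.univ.filter fun b => (∃ i, B i ∧ b = {i}) ∨ ∃ i, p i ≠ i ∧ b = {i, p i}

theorem mem_configOf {p : Fin m → Fin m} {B : Fin m → Prop} {b : Finset (Fin m)} :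
    b ∈ configOf p B ↔ (∃ i, B i ∧ b = {i}) ∨ ∃ i, p i ≠ i ∧ b = {i, p i} := by
  simp [configOf]

theorem ball_mem_configOf {p : Fin m → Fin m} {B : Fin m → Prop} (i : Fin m) :
    ({i} : Finset (Fin m)) ∈ configOf p B ↔ B i := by
  rw [mem_configOf]
  constructor
  · rintro (⟨j, hj, e⟩ | ⟨j, hj, e⟩)
    · rw [Finset.singleton_inj.1 e]
      exact hj
    · have := congrArg Finset.card e
      rw [Finset.card_singleton, Finset.card_pair hj.symm] at this
      omega
  · intro h
    exact Or.inl ⟨i, h, rfl⟩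

theorem pair_mem_configOf {p : Fin m → Fin m} {B : Fin m → Prop} (hp : ∀ i, p (p i) = i)
    {i j : Fin m} (hij : j ≠ i) : ({i, j} : Finset (Fin m)) ∈ configOf p B ↔ p i = j := by
  rw [mem_configOf]
  constructor
  · rintro (⟨k, hk, e⟩ | ⟨k, hk, e⟩)
    · have := congrArg Finset.card e
      rw [Finset.card_singleton, Finset.card_pair hij.symm] at this
      omega
    · have h1 : i ∈ ({k, p k} : Finset (Fin m)) := by rw [← e]; simp
      have h2 : j ∈ ({k, p k} : Finset (Fin m)) := by rw [← e]; simp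
      simp only [Finset.mem_insert, Finset.mem_singleton] at h1 h2
      rcases h1 with rfl | rfl <;> rcases h2 with rfl | rfl
      · exact absurd rfl hij
      · rfl
      · exact hp _
      · exact absurd rfl hij
  · rintro rfl
    exact Or.inr ⟨i, hij, rfl⟩

theorem isNCConfig_configOf {p : Fin m → Fin m} (hp : IsNCInvolution p) {B : Fin m → Prop}
    (hB : ∀ i, B i → p i = i) : IsNCConfig (configOf p B) where
  card_block := by
    intro b hb
    rcases mem_configOf.1 hb with ⟨i, -, rfl⟩ | ⟨i, hi, rfl⟩
    · exact Or.inl (Finset.card_singleton i)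
    · exact Or.inr (Finset.card_pair hi.symm)
  disjoint := by
    -- The block at a point `k` is `{k, p k}`, which is `{k}` when `k` is a ball.
    have key : ∀ b ∈ configOf p B, ∀ k ∈ b, b = {k, p k} := by
      intro b hb k hk
      rcases mem_configOf.1 hb with ⟨i, hi, rfl⟩ | ⟨i, hi, rfl⟩
      · rw [Finset.mem_singleton.1 hk, hB i hi, Finset.pair_eq_singleton]
      · simp only [Finset.mem_insert, Finset.mem_singleton] at hk
        rcases hk with rfl | rfl
        · rfl
        · rw [hp.invol, Finset.pair_comm]
    intro b hb c hc hbc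
    rw [Finset.disjoint_left]
    intro k hkb hkc
    exact hbc ((key b hb k hkb).trans (key c hc k hkc).symm)
  noncrossing := by
    rintro ⟨i₁, i₂, j₁, j₂, h1, h2, h3, h4, h5⟩
    rw [pair_mem_configOf hp.invol (h1.trans h2).ne'] at h4
    rw [pair_mem_configOf hp.invol (h2.trans h3).ne'] at h5
    subst h4 h5
    exact hp.noncrossing _ _ h1 h2 h3

theorem partner_configOf {p : Fin m → Fin m} (hp : IsNCInvolution p) {B : Fin m → Prop}
    (hB : ∀ i, B i → p i = i) (i : Fin m) : partner (configOf p B) i = p i := by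
  have hx := isNCConfig_configOf hp hB
  by_cases h : p i = i
  · by_contra hne
    rw [h] at hne
    have := (hx.partner_eq_iff hne).1 rfl
    rw [pair_mem_configOf hp.invol hne] at this
    rw [← this] at hne
    exact hne h
  · rw [hx.partner_eq_iff h, pair_mem_configOf hp.invol h]

end Partner

/-! ### Words of endpoints and isolated points -/

section Words

/-- The four kinds of vertices of a configuration: left endpoints `(true, true)`, right endpoints
`(false, false)`, balls `(false, true)` and empty vertices `(true, false)`. -/
abbrev Letter : Type := Bool × Bool

/-- The height change caused by a letter: `1` at left endpoints, `-1` at right endpoints. -/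
def step (a : Letter) : ℤ := (if a.1 then 1 else 0) + (if a.2 then 1 else 0) - 1

/-- The letter under reflection, which exchanges left and right endpoints. -/
def flipLetter (a : Letter) : Letter := (!a.2, !a.1)

theorem step_flipLetter (a : Letter) : step (flipLetter a) = -step a := by
  rcases a with ⟨_ | _, _ | _⟩ <;> rfl

open Classical in
/-- The letter of a vertex `i` with partner `j`, which is a ball if `b` holds. -/
noncomputable def letterAt {α : Type*} [LinearOrder α] (i j : α) (b : Prop) : Letter :=
  if i < j then (true, true) else if j < i then (false, false) else
    if b then (false, true) else (true, false)

variable {α β : Type*} [LinearOrder α] [LinearOrder β]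

theorem step_letterAt (i j : α) (b : Prop) :
    step (letterAt i j b) = if i < j then 1 else if j < i then -1 else 0 := by
  unfold letterAt
  split_ifs <;> rfl

theorem lt_iff_of_letterAt_eq {i j : α} {i' j' : β} {b b' : Prop}
    (h : letterAt i j b = letterAt i' j' b') : (i < j ↔ i' < j') ∧ (j < i ↔ j' < i') := by
  have e := congrArg step h
  rw [step_letterAt, step_letterAt] at e
  constructor <;> split_ifs at e <;>
    first | (exfalso; omega) | (constructor <;> intro <;> first | assumption | (exfalso; order))

theorem letterAt_congr {i j : α} {i' j' : β} {b b' : Prop} (h1 : i < j ↔ i' < j')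
    (h2 : j < i ↔ j' < i') (h3 : b ↔ b') : letterAt i j b = letterAt i' j' b' := by
  obtain rfl := propext h3
  unfold letterAt
  simp only [h1, h2]

theorem letterAt_eq_ball_iff {i j : α} {b : Prop} (hb : b → j = i) :
    letterAt i j b = (false, true) ↔ b := by
  unfold letterAt
  constructor
  · intro h
    split_ifs at h with h1 h2 h3
    · simp at h
    · simp at h
    · exact h3
    · simp at h
  · intro h
    have := hb h
    subst this
    simp [h]

theorem letterAt_eq_of_step {i j : α} {a : Letter} (h1 : i < j ↔ 0 < step a)
    (h2 : j < i ↔ step a < 0) : letterAt i j (a = (false, true)) = a := by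
  unfold letterAt
  simp only [h1, h2]
  rcases a with ⟨_ | _, _ | _⟩ <;> simp [step]

theorem eq_of_step_eq_zero {i j : α} {a : Letter} (h1 : i < j ↔ 0 < step a)
    (h2 : j < i ↔ step a < 0) (ha : a = (false, true)) : j = i := by
  subst ha
  simp only [step] at h1 h2
  exact le_antisymm (not_lt.1 (fun h => by simpa using h1.1 h))
    (not_lt.1 (fun h => by simpa using h2.1 h))

variable {m : ℕ}

/-- The word of a configuration. -/
noncomputable def word (x : Finset (Finset (Fin m))) (i : Fin m) : Letter :=
  letterAt i (partner x i) ({i} ∈ x)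

theorem IsNCConfig.word_injective {x y : Finset (Finset (Fin m))} (hx : IsNCConfig x)
    (hy : IsNCConfig y) (h : word x = word y) : x = y := by
  have hp : partner x = partner y := hx.isNCInvolution.eq_of_lt_iff hy.isNCInvolution
    (fun i => (lt_iff_of_letterAt_eq (congrFun h i)).1)
    (fun i => (lt_iff_of_letterAt_eq (congrFun h i)).2)
  refine hx.eq_of_partner hy (congrFun hp) fun i => ?_
  rw [← letterAt_eq_ball_iff hx.partner_of_ball, ← letterAt_eq_ball_iff hy.partner_of_ball]
  exact Eq.congr_left (congrFun h i)

/-- The height of a word after `k` letters. -/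
def height (w : Fin m → Letter) (k : ℕ) : ℤ := ∑ i : Fin m, if i.val < k then step (w i) else 0

theorem height_zero (w : Fin m → Letter) : height w 0 = 0 := by simp [height]

theorem height_of_le (w : Fin m → Letter) {k : ℕ} (hk : m ≤ k) : height w k = height w m := by
  refine Finset.sum_congr rfl fun i _ => ?_
  rw [if_pos i.2, if_pos (i.2.trans_le hk)]

theorem height_succ (w : Fin m → Letter) {k : ℕ} (hk : k < m) :
    height w (k + 1) = height w k + step (w ⟨k, hk⟩) := by
  have : ∀ i : Fin m, (if i.val < k + 1 then step (w i) else 0) =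
      (if i.val < k then step (w i) else 0) + if i = ⟨k, hk⟩ then step (w i) else 0 := by
    intro i
    simp only [Fin.ext_iff]
    rcases lt_trichotomy i.val k with h | h | h
    · simp [h, h.ne, h.trans (Nat.lt_succ_self k)]
    · simp [h]
    · rw [if_neg (by omega), if_neg (by omega), if_neg (by simpa using h.ne')]
      rfl
  rw [height, Finset.sum_congr rfl fun i _ => this i, Finset.sum_add_distrib, Finset.sum_ite_eq']
  simp [height]

/-- The words of nonnegative height that end at height `h`. -/
def ballotWords (m : ℕ) (h : ℤ) : Finset (Fin m → Letter) :=
  Finset.univ.filter fun w => (∀ k ≤ m, 0 ≤ height w k) ∧ height w m = h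

theorem mem_ballotWords {h : ℤ} {w : Fin m → Letter} :
    w ∈ ballotWords m h ↔ (∀ k ≤ m, 0 ≤ height w k) ∧ height w m = h := by
  simp [ballotWords]

theorem sum_step_eq_zero {p : Fin m → Fin m} (hp : IsNCInvolution p) (b : Fin m → Prop)
    (s : Finset (Fin m)) (hs : ∀ i ∈ s, p i ∈ s) : ∑ i ∈ s, step (letterAt i (p i) (b i)) = 0 := by
  refine Finset.sum_involution (fun i _ => p i) ?_ ?_ hs fun i _ => hp.invol i
  · intro i _
    rw [step_letterAt, step_letterAt, hp.invol]
    split_ifs <;> first | rfl | (exfalso; order)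
  · intro i _ hi e
    rw [step_letterAt, e] at hi
    simp at hi

theorem IsNCConfig.word_mem_ballotWords {x : Finset (Finset (Fin m))} (hx : IsNCConfig x) :
    word x ∈ ballotWords m 0 := by
  have hp := hx.isNCInvolution
  rw [mem_ballotWords]
  constructor
  · intro k _
    -- Arcs inside the prefix contribute nothing; an arc that leaves it starts in it.
    rw [height, ← Finset.sum_filter,
      ← Finset.sum_filter_add_sum_filter_not _ fun i => (partner x i).val < k]
    unfold word
    rw [sum_step_eq_zero hp _ _ (by
      intro i hi
      simp only [Finset.mem_filter, Finset.mem_univ, true_and] at hi ⊢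
      rw [hp.invol]
      exact ⟨hi.2, hi.1⟩), zero_add]
    refine Finset.sum_nonneg fun i hi => ?_
    simp only [Finset.mem_filter, Finset.mem_univ, true_and] at hi
    rw [step_letterAt, if_pos (by rw [Fin.lt_def]; omega)]
    exact zero_le_one
  · simp only [height, Fin.is_lt, if_true]
    exact sum_step_eq_zero hp _ _ fun _ _ => Finset.mem_univ _

/-- The height function of a ballot word, extended by `0` to all integers, is that of a noncrossing
involution. -/
theorem exists_word_eq {w : Fin m → Letter} (hw : w ∈ ballotWords m 0) :
    ∃ x, IsNCConfig x ∧ word x = w := by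
  rw [mem_ballotWords] at hw
  have hbig : ∀ k, m ≤ k → height w k = 0 := fun k hk => by rw [height_of_le w hk, hw.2]
  have hnn : ∀ k, 0 ≤ height w k := by
    intro k
    rcases le_total k m with h | h
    · exact hw.1 k h
    · exact (hbig k h).ge
  let h : ℤ → ℤ := fun i => height w i.toNat
  have hneg : ∀ i < 0, h (i + 1) = h i := by
    intro i hi
    change height w (i + 1).toNat = height w i.toNat
    rw [Int.toNat_of_nonpos hi.le, Int.toNat_of_nonpos (by omega)]
  have hlarge : ∀ i : ℤ, (m : ℤ) ≤ i → h i = 0 := fun i hi => hbig _ (by omega)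
  have hin : ∀ i : Fin m, h (i + 1) = h i + step (w i) := by
    intro i
    change height w ((i : ℤ) + 1).toNat = height w (i : ℤ).toNat + _
    rw [Int.toNat_natCast, show ((i : ℤ) + 1).toNat = i.val + 1 by omega, height_succ w i.2]
  have hcases : ∀ i : ℤ, (∃ a : Fin m, i = a) ∨ h (i + 1) = h i := by
    intro i
    rcases lt_or_ge i 0 with h0 | h0
    · exact Or.inr (hneg i h0)
    · rcases lt_or_ge i m with h1 | h1
      · exact Or.inl ⟨⟨i.toNat, by omega⟩, by simp [h0]⟩
      · exact Or.inr (by rw [hlarge i h1, hlarge (i + 1) (by omega)])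
  have hstep : ∀ a : Letter, -1 ≤ step a ∧ step a ≤ 1 := by decide
  obtain ⟨f, hf, hf1, hf2⟩ := exists_isNCInvolution h
    (fun i => by
      rcases hcases i with ⟨a, rfl⟩ | e
      · rw [hin]; have := hstep (w a); omega
      · omega)
    (fun i => by
      rcases hcases i with ⟨a, rfl⟩ | e
      · rw [hin]; have := hstep (w a); omega
      · omega)
    (fun i hi => by
      rcases hcases i with ⟨a, rfl⟩ | e
      · exact ⟨m, by have := a.2; omega, by rw [hlarge _ (by omega)]; exact hnn _⟩
      · omega)
    (fun i hi => by
      rcases hcases i with ⟨a, rfl⟩ | e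
      · refine ⟨-1, by omega, ?_⟩
        change height w 0 ≤ _
        rw [height_zero]
        exact hnn _
      · omega)
  have hout : ∀ i, h (i + 1) = h i → f i = i := by
    intro i e
    have h1 := hf1 i
    have h2 := hf2 i
    omega
  have hrange : ∀ a : Fin m, ∃ b : Fin m, f a = b := by
    intro a
    rcases hcases (f a) with h1 | h1
    · exact h1
    · have := hout _ h1
      rw [hf.invol] at this
      exact ⟨a, this.symm⟩
  choose p hp using hrange
  have hpNC : IsNCInvolution p := by
    constructor
    · intro i
      have : ((p (p i) : Fin m) : ℤ) = i := by rw [← hp, ← hp, hf.invol]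
      exact Fin.ext (by exact_mod_cast this)
    · intro i j h1 h2 h3
      have e1 := hp i
      have e2 := hp j
      rw [Fin.lt_def] at h1 h2 h3
      exact hf.noncrossing i j (by omega) (by omega) (by omega)
  have hlt1 : ∀ i, i < p i ↔ 0 < step (w i) := by
    intro i
    have e1 := hf1 i
    rw [hp, hin] at e1
    rw [Fin.lt_def]
    omega
  have hlt2 : ∀ i, p i < i ↔ step (w i) < 0 := by
    intro i
    have e1 := hf2 i
    rw [hp, hin] at e1
    rw [Fin.lt_def]
    omega
  have hB : ∀ i, w i = (false, true) → p i = i :=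
    fun i hi => eq_of_step_eq_zero (hlt1 i) (hlt2 i) hi
  refine ⟨configOf p fun i => w i = (false, true), isNCConfig_configOf hpNC hB, ?_⟩
  ext1 i
  rw [word, partner_configOf hpNC hB, ball_mem_configOf]
  exact letterAt_eq_of_step (hlt1 i) (hlt2 i)

/-- Noncrossing configurations correspond to ballot words. -/
noncomputable def wordEquiv (m : ℕ) :
    {x : Finset (Finset (Fin m)) // IsNCConfig x} ≃ {w // w ∈ ballotWords m 0} :=
  Equiv.ofBijective (fun x => ⟨word x.1, x.2.word_mem_ballotWords⟩) (by
    constructor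
    · intro x y h
      exact Subtype.ext (x.2.word_injective y.2 (congrArg Subtype.val h))
    · rintro ⟨w, hw⟩
      obtain ⟨x, hx, rfl⟩ := exists_word_eq hw
      exact ⟨⟨x, hx⟩, rfl⟩)

theorem card_config (m : ℕ) :
    Nat.card {x : Finset (Finset (Fin m)) // IsNCConfig x} = (ballotWords m 0).card := by
  rw [Nat.card_congr (wordEquiv m), Nat.card_eq_fintype_card, Fintype.card_coe]

/-- Reflecting a configuration reverses its word and exchanges left and right endpoints. -/
theorem IsNCConfig.word_reflection {x : Finset (Finset (Fin m))} (hx : IsNCConfig x) (i : Fin m) :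
    word (mapBlocks (reflection m) x) i.rev = flipLetter (word x i) := by
  have h1 := hx.partner_mapBlocks (reflection m) hx.map_reflection i
  have h2 := ball_mem_mapBlocks (reflection m) x i
  change partner (mapBlocks (reflection m) x) i.rev = (partner x i).rev at h1
  change {i.rev} ∈ mapBlocks (reflection m) x ↔ _ at h2
  unfold word letterAt
  simp only [h1, h2, Fin.rev_lt_rev]
  split_ifs with h3 h4 <;> first | rfl | (exfalso; order)

/-- The ballot words that are invariant under reversal combined with `flipLetter`. -/
def symmetricWords (m : ℕ) : Finset (Fin m → Letter) :=
  (ballotWords m 0).filter fun w => ∀ i, w i.rev = flipLetter (w i)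

/-- By injectivity of `word`, the configurations fixed by the reflection have symmetric words. -/
theorem card_fixed_reflection (m : ℕ) :
    Nat.card {x : {x : Finset (Finset (Fin m)) // IsNCConfig x} //
      mapBlocks (reflection m) x.1 = x.1} = (symmetricWords m).card := by
  have e : {x : {x : Finset (Finset (Fin m)) // IsNCConfig x} //
      mapBlocks (reflection m) x.1 = x.1} ≃ {w // w ∈ symmetricWords m} := by
    refine (Equiv.subtypeEquiv (wordEquiv m)
      (q := fun w => ∀ i, w.1 i.rev = flipLetter (w.1 i)) ?_).trans
      ((Equiv.subtypeSubtypeEquivSubtypeInter (fun w => w ∈ ballotWords m 0)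
        (fun w => ∀ i, w i.rev = flipLetter (w i))).trans
        (Equiv.subtypeEquivRight fun w => by rw [symmetricWords, Finset.mem_filter]))
    rintro ⟨x, hx⟩
    change mapBlocks (reflection m) x = x ↔ ∀ i : Fin m, word x i.rev = flipLetter (word x i)
    constructor
    · intro h i
      have := hx.word_reflection i
      rwa [h] at this
    · intro h
      refine hx.map_reflection.word_injective hx (funext fun i => ?_)
      have := hx.word_reflection i.rev
      rw [Fin.rev_rev] at this
      rw [this, ← h, Fin.rev_rev]
  rw [Nat.card_congr e, Nat.card_eq_fintype_card, Fintype.card_coe]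

end Words

/-! ### Counting words -/

section WordCount

theorem height_init {m : ℕ} (w : Fin (m + 1) → Letter) {k : ℕ} (hk : k ≤ m) :
    height w k = height (Fin.init w) k := by
  rw [height, Fin.sum_univ_castSucc, if_neg (by simpa using hk), add_zero]
  rfl

theorem card_ballotWords_zero (h : ℤ) : (ballotWords 0 h).card = if h = 0 then 1 else 0 := by
  have : ∀ w : Fin 0 → Letter, w ∈ ballotWords 0 h ↔ h = 0 := by
    intro w
    rw [mem_ballotWords]
    simp [height, eq_comm]
  split_ifs with h0
  · rw [Finset.card_eq_one]
    exact ⟨Fin.elim0, Finset.ext fun w => iff_of_true ((this w).2 h0)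
      (Finset.mem_singleton.2 (Subsingleton.elim _ _))⟩
  · rw [Finset.card_eq_zero]
    exact Finset.eq_empty_of_forall_notMem fun w hw => h0 ((this w).1 hw)

theorem ballotWords_of_neg (m : ℕ) {h : ℤ} (hh : h < 0) : ballotWords m h = ∅ := by
  refine Finset.eq_empty_of_forall_notMem fun w hw => ?_
  rw [mem_ballotWords] at hw
  have := hw.1 m le_rfl
  omega

theorem mem_ballotWords_succ {m : ℕ} {h : ℤ} (hh : 0 ≤ h) (w : Fin (m + 1) → Letter) :
    w ∈ ballotWords (m + 1) h ↔ Fin.init w ∈ ballotWords m (h - step (w (Fin.last m))) := by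
  rw [mem_ballotWords, mem_ballotWords]
  have e1 : height w (m + 1) = height (Fin.init w) m + step (w (Fin.last m)) := by
    rw [height_succ w (Nat.lt_succ_self m), height_init w le_rfl]
    rfl
  constructor
  · rintro ⟨h1, h2⟩
    refine ⟨fun k hk => ?_, by omega⟩
    rw [← height_init w hk]
    exact h1 k (by omega)
  · rintro ⟨h1, h2⟩
    refine ⟨fun k hk => ?_, by omega⟩
    rcases Nat.lt_or_ge m k with hk' | hk'
    · rw [show k = m + 1 by omega]
      omega
    · rw [height_init w hk']
      exact h1 k hk'

theorem card_ballotWords_succ (m : ℕ) {h : ℤ} (hh : 0 ≤ h) : (ballotWords (m + 1) h).card =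
    (ballotWords m (h - 1)).card + 2 * (ballotWords m h).card + (ballotWords m (h + 1)).card := by
  have key : ∀ a : Letter, ((ballotWords (m + 1) h).filter fun w => w (Fin.last m) = a).card =
      (ballotWords m (h - step a)).card := by
    intro a
    refine Finset.card_nbij' (fun w => Fin.init w) (fun u => Fin.snoc (α := fun _ => Letter) u a)
      ?_ ?_ ?_ ?_
    · intro w hw
      have hw := Finset.mem_filter.1 hw
      rw [mem_ballotWords_succ hh, hw.2] at hw
      exact hw.1
    · intro u hu
      refine Finset.mem_filter.2 ⟨(mem_ballotWords_succ hh _).2 ?_, Fin.snoc_last _ _⟩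
      dsimp only
      rw [Fin.init_snoc, Fin.snoc_last]
      exact hu
    · intro w hw
      have hw := Finset.mem_filter.1 hw
      dsimp only
      rw [← hw.2]
      exact Fin.snoc_init_self w
    · intro u _
      exact Fin.init_snoc (α := fun _ => Letter) _ _
  rw [Finset.card_eq_sum_card_fiberwise (f := fun w => w (Fin.last m)) (t := Finset.univ)
    fun _ _ => Finset.mem_univ _, Finset.sum_congr rfl fun a _ => key a, Fintype.sum_prod_type]
  simp only [Fintype.sum_bool]
  norm_num [step]
  ring

theorem choose_add_two (N j : ℕ) :
    (N + 2).choose (j + 2) = N.choose j + 2 * N.choose (j + 1) + N.choose (j + 2) := by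
  rw [Nat.choose_succ_succ' (N + 1), Nat.choose_succ_succ' N, Nat.choose_succ_succ' N]
  ring

/-- The reflection principle: a difference of two binomial coefficients satisfies the recursion of
the ballot words and vanishes at height `-1`. -/
theorem card_ballotWords (m h : ℕ) : ((ballotWords m h).card : ℤ) =
    (2 * m).choose (m + h) - (2 * m).choose (m + h + 2) := by
  induction m generalizing h with
  | zero =>
    rw [card_ballotWords_zero]
    rcases h with _ | h
    · simp
    · rw [if_neg (by omega)]
      simp
  | succ m ih =>
    rw [card_ballotWords_succ m (by omega), show 2 * (m + 1) = 2 * m + 2 by ring]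
    push_cast
    rcases h with _ | h
    · have e1 := ih 0
      have e2 := ih 1
      have e3 := choose_add_two (2 * m) (m + 1)
      rw [ballotWords_of_neg m (show ((0 : ℕ) : ℤ) - 1 < 0 by simp)]
      rw [show ((1 : ℕ) : ℤ) = ((0 : ℕ) : ℤ) + 1 by simp] at e2
      rw [e1, e2]
      have e4 : (2 * m + 2).choose (m + 1) = 2 * (2 * m).choose m + 2 * (2 * m).choose (m + 1) := by
        rcases m with _ | m
        · rfl
        · rw [choose_add_two, Nat.choose_symm_of_eq_add (show 2 * (m + 1) = m + (m + 2) by ring)]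
          ring
      simp only [Nat.add_zero, Finset.card_empty] at *
      rw [show m + 1 + 2 = m + 3 by ring] at *
      push_cast [e3, e4]
      ring
    · have e1 := ih h
      have e2 := ih (h + 1)
      have e3 := ih (h + 2)
      rw [show ((h + 1 : ℕ) : ℤ) - 1 = h by push_cast; ring,
        show ((h + 1 : ℕ) : ℤ) + 1 = (h + 2 : ℕ) by push_cast; ring, e1, e2, e3,
        show m + 1 + (h + 1) = m + h + 2 by ring, show m + h + 2 + 2 = m + h + 2 + 2 by ring,
        choose_add_two, choose_add_two]
      push_cast
      ring_nf

/-- The number of ballot words of length `m` that return to height `0` is the Catalan number of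
index `m + 1`. -/
theorem card_ballotWords_mul_factorial (m : ℕ) :
    (ballotWords m 0).card * ((m + 1).factorial * (m + 2).factorial) = (2 * m + 2).factorial := by
  have h := card_ballotWords m 0
  rw [Nat.cast_zero, add_zero] at h
  have h1 := Nat.choose_succ_right_eq (2 * m) m
  have h2 := Nat.choose_succ_right_eq (2 * m) (m + 1)
  have h3 := Nat.choose_mul_factorial_mul_factorial (show m ≤ 2 * m by omega)
  rw [show 2 * m - m = m by omega] at h1 h3
  have h1' : ((2 * m).choose (m + 1) * (m + 1) : ℤ) = (2 * m).choose m * m := by exact_mod_cast h1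
  have h2' : ((2 * m).choose (m + 2) * (m + 2) : ℤ) = (2 * m).choose (m + 1) * (m - 1) := by
    rcases m with _ | m
    · simp
    · rw [show 2 * (m + 1) - (m + 1 + 1) = m by omega] at h2
      have : ((2 * (m + 1)).choose (m + 1 + 1 + 1) * (m + 1 + 1 + 1) : ℤ) =
        (2 * (m + 1)).choose (m + 1 + 1) * m := by exact_mod_cast h2
      push_cast
      linear_combination this
  have h3' : ((2 * m).choose m * m.factorial * m.factorial : ℤ) = (2 * m).factorial := by
    exact_mod_cast h3
  have key : (((ballotWords m 0).card : ℤ) * ((m + 1).factorial * (m + 2).factorial)) =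
      (2 * m + 2).factorial := by
    rw [h, show (m + 2).factorial = (m + 2) * ((m + 1) * m.factorial) from by
      rw [Nat.factorial_succ, Nat.factorial_succ], Nat.factorial_succ m,
      show (2 * m + 2).factorial = (2 * m + 2) * ((2 * m + 1) * (2 * m).factorial) from by
      rw [Nat.factorial_succ, Nat.factorial_succ]]
    push_cast
    rw [← h3']
    linear_combination (-(m + 1) * (m + 1) * m.factorial * m.factorial : ℤ) * h2' -
      (m - 1) * (m + 1) * m.factorial * m.factorial * h1'
  exact_mod_cast key

/-- The words of nonnegative height. -/
def prefixWords (m : ℕ) : Finset (Fin m → Letter) :=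
  Finset.univ.filter fun w => ∀ k ≤ m, 0 ≤ height w k

theorem height_le {m : ℕ} (w : Fin m → Letter) : height w m ≤ m := by
  have hstep : ∀ a : Letter, step a ≤ 1 := by decide
  calc height w m ≤ ∑ i : Fin m, (1 : ℤ) := Finset.sum_le_sum fun i _ => by
        rw [if_pos i.2]; exact hstep _
    _ = m := by simp

/-- The counts of the ballot words telescope when summed over the final height. -/
theorem card_prefixWords (m : ℕ) : (prefixWords m).card = (2 * m + 1).choose (m + 1) := by
  have h1 : (prefixWords m).card = ∑ h ∈ Finset.range (m + 1), (ballotWords m h).card := by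
    rw [Finset.card_eq_sum_card_fiberwise (f := fun w => (height w m).toNat)
      (t := Finset.range (m + 1))]
    · refine Finset.sum_congr rfl fun h _ => congrArg Finset.card (Finset.ext fun w => ?_)
      simp only [prefixWords, ballotWords, Finset.mem_filter, Finset.mem_univ, true_and]
      refine and_congr_right fun hw => ?_
      have := hw m le_rfl
      omega
    · intro w _
      have := height_le w
      simp only [Finset.coe_range, Set.mem_Iio]
      omega
  have h2 : ∀ N : ℕ, ∑ h ∈ Finset.range N, ((ballotWords m h).card : ℤ) =
      (2 * m).choose m + (2 * m).choose (m + 1) - (2 * m).choose (m + N) -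
        (2 * m).choose (m + N + 1) := by
    intro N
    induction N with
    | zero => simp
    | succ N ih =>
      rw [Finset.sum_range_succ, ih, card_ballotWords]
      ring_nf
  have h3 := h2 (m + 1)
  rw [Nat.choose_eq_zero_of_lt (show 2 * m < m + (m + 1) by omega),
    Nat.choose_eq_zero_of_lt (show 2 * m < m + (m + 1) + 1 by omega)] at h3
  rw [Nat.choose_succ_succ', h1]
  have : ((∑ h ∈ Finset.range (m + 1), (ballotWords m h).card : ℕ) : ℤ) =
      ((2 * m).choose m + (2 * m).choose (m + 1) : ℕ) := by
    push_cast
    rw [h3]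
    push_cast
    ring
  exact_mod_cast this

/-- The height of an antisymmetric word is symmetric. -/
theorem height_symm {m : ℕ} {w : Fin m → Letter} (hw : ∀ i, w i.rev = flipLetter (w i)) {k l : ℕ}
    (hkl : k + l = m) : height w k = height w l := by
  have hneg : ∀ i, step (w i.rev) = -step (w i) := fun i => by rw [hw, step_flipLetter]
  have htot : ∑ i, step (w i) = 0 := by
    have h1 : ∑ i : Fin m, step (w i.rev) = ∑ i, step (w i) :=
      Equiv.sum_comp Fin.revPerm fun i => step (w i)
    simp only [hneg, Finset.sum_neg_distrib] at h1
    omega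
  have h2 : height w l = ∑ i : Fin m, if i.rev.val < l then step (w i.rev) else 0 :=
    (Equiv.sum_comp Fin.revPerm fun i : Fin m => if i.val < l then step (w i) else 0).symm
  rw [h2, height, ← sub_eq_zero, ← Finset.sum_sub_distrib, ← htot]
  refine Finset.sum_congr rfl fun i _ => ?_
  have := Fin.val_rev i
  have hi := i.2
  rw [hneg]
  split_ifs <;> omega

/-- A symmetric word of odd length is given by its first half and the colour of its central
letter. -/
theorem card_symmetricWords (L : ℕ) :
    (symmetricWords (2 * L + 1)).card = (2 * (L + 1)).choose (L + 1) := by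
  have hcard : (2 * (L + 1)).choose (L + 1) =
      (prefixWords L ×ˢ (Finset.univ : Finset Bool)).card := by
    rw [Finset.card_product, card_prefixWords, Finset.card_univ, Fintype.card_bool,
      show 2 * (L + 1) = 2 * L + 1 + 1 by ring, Nat.choose_succ_succ',
      Nat.choose_symm_of_eq_add (show 2 * L + 1 = L + (L + 1) by ring)]
    ring
  rw [hcard]
  -- Heights of the half word.
  have hhalf : ∀ (w : Fin (2 * L + 1) → Letter) (u : Fin L → Letter),
      (∀ i : Fin L, w ⟨i.val, by omega⟩ = u i) → ∀ k ≤ L, height w k = height u k := by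
    intro w u hu k hk
    induction k with
    | zero => rw [height_zero, height_zero]
    | succ k ih =>
      rw [height_succ w (by omega), height_succ u (by omega), ih (by omega), ← hu]
  -- The default letter `(true, false)` in the inverse map is never used.
  refine Finset.card_nbij' (fun w => (fun i : Fin L => w ⟨i.val, by omega⟩, (w ⟨L, by omega⟩).1))
    (fun p i => if h : i.val < L then p.1 ⟨i.val, h⟩ else if i.val = L then (p.2, !p.2) else
      flipLetter (if h : i.rev.val < L then p.1 ⟨i.rev.val, h⟩ else (true, false))) ?_ ?_ ?_ ?_
  · intro w hw
    have hw := Finset.mem_filter.1 hw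
    rw [mem_ballotWords] at hw
    simp only [Finset.coe_product, Set.mem_prod, Finset.mem_coe, Finset.mem_univ, and_true]
    rw [prefixWords, Finset.mem_filter]
    refine ⟨Finset.mem_univ _, fun k hk => ?_⟩
    rw [← hhalf w _ (fun _ => rfl) k hk]
    exact hw.1.1 k (by omega)
  · rintro ⟨u, c⟩ hu
    have hu : ∀ k ≤ L, 0 ≤ height u k := by
      simpa [prefixWords] using hu
    dsimp only
    set w : Fin (2 * L + 1) → Letter := fun i => if h : i.val < L then u ⟨i.val, h⟩ else
      if i.val = L then (c, !c) else
      flipLetter (if h : i.rev.val < L then u ⟨i.rev.val, h⟩ else (true, false)) with hwdef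
    have hflip : ∀ a, flipLetter (flipLetter a) = a := by decide
    have hsymm : ∀ i, w i.rev = flipLetter (w i) := by
      intro i
      have h1 := Fin.val_rev i
      have h2 := i.2
      rcases lt_trichotomy i.val L with h | h | h
      · rw [hwdef]
        simp only [Fin.rev_rev]
        rw [dif_neg (by omega), if_neg (by omega), dif_pos h, dif_pos h]
      · rw [hwdef]
        simp only
        rw [dif_neg (by omega), if_pos (by omega), dif_neg (by omega), if_pos h]
        simp [flipLetter]
      · rw [hwdef]
        simp only
        rw [dif_pos (by omega), dif_neg (by omega), if_neg (by omega), dif_pos (by omega), hflip]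
    have hw : ∀ k ≤ L, height w k = height u k := hhalf w u fun i => by simp [hwdef]
    refine Finset.mem_filter.2 ⟨mem_ballotWords.2 ⟨fun k hk => ?_, ?_⟩, hsymm⟩
    · rcases le_total k L with h | h
      · rw [hw k h]
        exact hu k h
      · rcases eq_or_lt_of_le h with rfl | h
        · rw [hw _ le_rfl]
          exact hu _ le_rfl
        · rw [height_symm hsymm (show k + (2 * L + 1 - k) = _ by omega), hw _ (by omega)]
          exact hu _ (by omega)
    · rw [height_symm hsymm (add_zero _), height_zero]
  · intro w hw
    have hw := (Finset.mem_filter.1 hw).2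
    ext1 i
    have h1 := Fin.val_rev i
    have h2 := i.2
    dsimp only
    split_ifs with h3 h4 h5
    · rfl
    · have e1 : i = ⟨L, by omega⟩ := Fin.ext h4
      have e2 := hw i
      rw [show i.rev = i from Fin.ext (by omega)] at e2
      rw [← e1]
      have hfix : ∀ a : Letter, a = flipLetter a → (a.1, !a.1) = a := by decide
      exact hfix _ e2
    · have e2 := hw i.rev
      rw [Fin.rev_rev] at e2
      exact e2.symm
    · omega
  · rintro ⟨u, c⟩ _
    simp

end WordCount

/-! ### Configurations with rotational symmetry -/

section Rotation

variable {m : ℕ} [NeZero m]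

/-- The residue of an integer, as a vertex. -/
def residue (m : ℕ) [NeZero m] (i : ℤ) : Fin m :=
  ⟨(i % m).toNat, by
    have := Int.emod_lt_of_pos i (show (0 : ℤ) < m by exact_mod_cast NeZero.pos m)
    have := Int.emod_nonneg i (show (m : ℤ) ≠ 0 by exact_mod_cast NeZero.ne m)
    omega⟩

theorem residue_val (i : ℤ) : ((residue m i : Fin m) : ℤ) = i % m := by
  have := Int.emod_nonneg i (show (m : ℤ) ≠ 0 by exact_mod_cast NeZero.ne m)
  simp [residue, this]

theorem residue_eq_iff (i j : ℤ) : residue m i = residue m j ↔ (m : ℤ) ∣ i - j := by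
  rw [Fin.ext_iff, ← Int.natCast_inj, residue_val, residue_val]
  exact Int.emod_eq_emod_iff_emod_sub_eq_zero.trans Int.dvd_iff_emod_eq_zero.symm

theorem residue_natCast (a : Fin m) : residue m a = a := by
  rw [Fin.ext_iff, ← Int.natCast_inj, residue_val]
  exact Int.emod_eq_of_lt (by omega) (by have := a.2; omega)

theorem dvd_sub_residue (i : ℤ) : (m : ℤ) ∣ i - (residue m i : Fin m) := by
  rw [← residue_eq_iff, residue_natCast]

theorem eq_of_residue_eq {i j : ℤ} (h : residue m i = residue m j) (h1 : i - j < m)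
    (h2 : j - i < m) : i = j := by
  rw [residue_eq_iff] at h
  have := Int.eq_zero_of_abs_lt_dvd h (by rw [abs_lt]; omega)
  omega

/-- The lift of a self-map of `Fin m` to the integers, with displacements of least absolute
value. -/
def cyclicLift (p : Fin m → Fin m) (i : ℤ) : ℤ := i + Int.bmod (p (residue m i) - i) m

theorem residue_cyclicLift (p : Fin m → Fin m) (i : ℤ) :
    residue m (cyclicLift p i) = p (residue m i) := by
  rw [← residue_natCast (p (residue m i)), residue_eq_iff, cyclicLift]
  have := Int.dvd_bmod_sub_self (x := p (residue m i) - i) (m := m)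
  rwa [show i + Int.bmod (p (residue m i) - i) m - p (residue m i) =
    Int.bmod (p (residue m i) - i) m - (p (residue m i) - i) by ring]

theorem cyclicLift_sub_lt (hm : Odd m) (p : Fin m → Fin m) (i : ℤ) :
    2 * (cyclicLift p i - i) < m ∧ 2 * (i - cyclicLift p i) < m := by
  have h1 := Int.bmod_lt (x := p (residue m i) - i) (m := m) (NeZero.pos m)
  have h2 := Int.le_bmod (x := p (residue m i) - i) (m := m) (NeZero.pos m)
  obtain ⟨t, ht⟩ := hm
  have : (m : ℤ) = 2 * t + 1 := by exact_mod_cast ht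
  rw [cyclicLift]
  omega

theorem eq_cyclicLift (hm : Odd m) {p : Fin m → Fin m} {i j : ℤ}
    (h : residue m j = p (residue m i)) (h1 : 2 * (j - i) < m) (h2 : 2 * (i - j) < m) :
    j = cyclicLift p i := by
  have h3 := cyclicLift_sub_lt hm p i
  refine eq_of_residue_eq (m := m) ?_ (by omega) (by omega)
  rw [h, residue_cyclicLift]

/-- The arcs of a noncrossing involution do not cross in the cyclic order either. -/
theorem IsNCInvolution.cyclic_noncrossing {p : Fin m → Fin m} (hp : IsNCInvolution p)
    {a b c d : ℤ} (h1 : a < b) (h2 : b < c) (h3 : c < d) (h4 : d < a + m)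
    (hac : p (residue m a) = residue m c) (hbd : p (residue m b) = residue m d) : False := by
  -- All four points lie in a window of length `m`; only the place where it wraps around matters.
  have hq := Int.emod_add_mul_ediv a m
  have ha0 := Int.emod_nonneg a (show (m : ℤ) ≠ 0 by exact_mod_cast NeZero.ne m)
  have ha1 := Int.emod_lt_of_pos a (show (0 : ℤ) < m by exact_mod_cast NeZero.pos m)
  set M := (m : ℤ) * (a / m) with hM
  have hres : ∀ z, M ≤ z → z < M + m → ((residue m z : Fin m) : ℤ) = z - M := by
    intro z hz1 hz2
    rw [residue_val, ← Int.emod_eq_of_lt (show 0 ≤ z - M by omega) (show z - M < m by omega),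
      hM, Int.sub_mul_emod_self_left]
  have hres' : ∀ z, M + m ≤ z → z < M + m + m → ((residue m z : Fin m) : ℤ) = z - M - m := by
    intro z hz1 hz2
    have := hres (z - m) (by omega) (by omega)
    rw [residue_val, Int.sub_emod_right, ← residue_val] at this
    omega
  have hca : p (residue m c) = residue m a := by rw [← hac, hp.invol]
  have hdb : p (residue m d) = residue m b := by rw [← hbd, hp.invol]
  have ra := hres a (by omega) (by omega)
  have nc := hp.noncrossing
  have n1 := nc (residue m a) (residue m b)
  have n2 := nc (residue m d) (residue m a)
  have n3 := nc (residue m c) (residue m d)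
  have n4 := nc (residue m b) (residue m c)
  rw [hac, hbd] at n1
  rw [hdb, hac] at n2
  rw [hca, hdb] at n3
  rw [hbd, hca] at n4
  simp only [Fin.lt_def] at n1 n2 n3 n4
  rcases lt_or_ge d (M + m) with hd | hd
  · have := hres b (by omega) (by omega)
    have := hres c (by omega) (by omega)
    have := hres d (by omega) (by omega)
    exact n1 (by omega) (by omega) (by omega)
  · have := hres' d (by omega) (by omega)
    rcases lt_or_ge c (M + m) with hc | hc
    · have := hres b (by omega) (by omega)
      have := hres c (by omega) (by omega)
      exact n2 (by omega) (by omega) (by omega)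
    · have := hres' c (by omega) (by omega)
      rcases lt_or_ge b (M + m) with hb | hb
      · have := hres b (by omega) (by omega)
        exact n3 (by omega) (by omega) (by omega)
      · have := hres' b (by omega) (by omega)
        exact n4 (by omega) (by omega) (by omega)

theorem cyclicLift_invol (hm : Odd m) {p : Fin m → Fin m} (hp : ∀ i, p (p i) = i) (i : ℤ) :
    cyclicLift p (cyclicLift p i) = i := by
  have h := cyclicLift_sub_lt hm p i
  refine (eq_cyclicLift hm ?_ (by omega) (by omega)).symm
  rw [residue_cyclicLift, hp]

theorem cyclicLift_add (hm : Odd m) {p : Fin m → Fin m} {e : ℕ}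
    (hpe : ∀ i : ℤ, p (residue m (i + e)) = residue m (p (residue m i) + e)) (i : ℤ) :
    cyclicLift p (i + e) = cyclicLift p i + e := by
  have h := cyclicLift_sub_lt hm p i
  refine (eq_cyclicLift hm ?_ (by omega) (by omega)).symm
  rw [hpe, residue_eq_iff]
  have h2 : residue m (cyclicLift p i) = residue m (p (residue m i)) := by
    rw [residue_cyclicLift, residue_natCast]
  rw [residue_eq_iff] at h2
  rwa [add_sub_add_right_eq_sub]

/-- If a noncrossing involution is invariant under a rotation by at most a third of the circle, its
lift to the integers is noncrossing: its arcs are shorter than the rotation. -/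
theorem isNCInvolution_cyclicLift (hm : Odd m) {p : Fin m → Fin m} (hp : IsNCInvolution p) {e : ℕ}
    (he : 3 * e ≤ m) (he0 : 0 < e)
    (hpe : ∀ i : ℤ, p (residue m (i + e)) = residue m (p (residue m i) + e)) :
    IsNCInvolution (cyclicLift p) := by
  have hinv := cyclicLift_invol hm hp.invol
  have hadd := cyclicLift_add hm hpe
  have hcross : ∀ a b c d : ℤ, a < b → b < c → c < d → d < a + m → cyclicLift p a = c →
      cyclicLift p b = d → False := by
    intro a b c d h1 h2 h3 h4 hac hbd
    refine hp.cyclic_noncrossing h1 h2 h3 h4 ?_ ?_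
    · rw [← hac, residue_cyclicLift]
    · rw [← hbd, residue_cyclicLift]
  have hshort : ∀ i, cyclicLift p i < i + e := by
    intro i
    by_contra hc
    have h1 := cyclicLift_sub_lt hm p i
    rcases eq_or_lt_of_le (not_lt.1 hc) with h2 | h2
    · have h3 := hadd i
      rw [h2, hinv] at h3
      omega
    · exact hcross i (i + e) (cyclicLift p i) (cyclicLift p i + e) (by omega) (by omega) (by omega)
        (by omega) rfl (hadd i)
  refine ⟨hinv, fun i j h1 h2 h3 => ?_⟩
  have := hshort i
  have := hshort j
  exact hcross i j _ _ h1 h2 h3 (by omega) rfl rfl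

/-- The words of length `e` and total height zero. -/
def balancedWords (e : ℕ) : Finset (Fin e → Letter) :=
  Finset.univ.filter fun w => ∑ i, step (w i) = 0

/-- Reading the two bits of each letter, a word of total height zero is a choice of `e` out of `2e`
positions. -/
theorem card_balancedWords (e : ℕ) : (balancedWords e).card = (2 * e).choose e := by
  have hcard : (2 * e).choose e =
      (Finset.powersetCard e (Finset.univ : Finset (Fin e × Bool))).card := by
    rw [Finset.card_powersetCard, Finset.card_univ, Fintype.card_prod, Fintype.card_fin,
      Fintype.card_bool, mul_comm]
  have hsum : ∀ s : Finset (Fin e × Bool), ∑ i : Fin e,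
      step (decide ((i, true) ∈ s), decide ((i, false) ∈ s)) = s.card - e := by
    intro s
    have : (s.card : ℤ) = ∑ i : Fin e, ∑ b : Bool, if (i, b) ∈ s then 1 else 0 := by
      rw [← Fintype.sum_prod_type' fun i b => if (i, b) ∈ s then (1 : ℤ) else 0]
      simp
    rw [this]
    simp only [Fintype.sum_bool]
    simp [step, Finset.sum_sub_distrib]
  rw [hcard]
  symm
  refine Finset.card_nbij' (fun s i => (decide ((i, true) ∈ s), decide ((i, false) ∈ s)))
    (fun w => Finset.univ.filter fun q => if q.2 then (w q.1).1 else (w q.1).2) ?_ ?_ ?_ ?_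
  · intro s hs
    have hs := (Finset.mem_powersetCard.1 hs).2
    refine Finset.mem_filter.2 ⟨Finset.mem_univ _, ?_⟩
    rw [hsum, hs, sub_self]
  · intro w hw
    have hw := (Finset.mem_filter.1 hw).2
    refine Finset.mem_powersetCard.2 ⟨Finset.subset_univ _, ?_⟩
    have := hsum (Finset.univ.filter fun q => if q.2 then (w q.1).1 else (w q.1).2)
    simp only [Finset.mem_filter, Finset.mem_univ, true_and, if_true, Bool.false_eq_true,
      if_false, Bool.decide_eq_true, Prod.mk.eta] at this
    rw [hw] at this
    dsimp only
    omega
  · intro s _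
    ext ⟨i, b⟩
    cases b <;> simp
  · intro w _
    ext1 i
    simp

theorem residue_add_natCast {e : ℕ} (x : Fin m) :
    ((rotation m ^ e) x) = residue m ((x : ℤ) + e) := by
  rw [Fin.ext_iff, ← Int.natCast_inj, residue_val, rotation_pow_val]
  push_cast
  rfl

/-- The word of one period of a rotationally symmetric configuration, in the cyclic order. -/
noncomputable def cyclicWord (e : ℕ) (x : Finset (Finset (Fin m))) (a : Fin e) : Letter :=
  letterAt (a : ℤ) (cyclicLift (partner x) a) ({residue m a} ∈ x)

/-- The letter of an integer in the periodic extension of a configuration. -/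
noncomputable def cyclicLetter (x : Finset (Finset (Fin m))) (i : ℤ) : Letter :=
  letterAt i (cyclicLift (partner x) i) ({residue m i} ∈ x)

theorem isNCConfig_rotation_pow {m : ℕ} {x : Finset (Finset (Fin m))} (hx : IsNCConfig x) (k : ℕ) :
    IsNCConfig (mapBlocks (rotation m ^ k) x) := by
  induction k with
  | zero => rw [pow_zero, mapBlocks_one]; exact hx
  | succ k ih => rw [pow_succ', mapBlocks_mul]; exact ih.map_rotation

theorem residue_add (i : ℤ) (e : ℕ) : residue m (i + e) = (rotation m ^ e) (residue m i) := by
  rw [residue_add_natCast, residue_eq_iff, add_sub_add_right_eq_sub]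
  exact dvd_sub_residue i

theorem IsNCConfig.partner_residue_add {x : Finset (Finset (Fin m))} (hx : IsNCConfig x) {e : ℕ}
    (hfix : mapBlocks (rotation m ^ e) x = x) (i : ℤ) :
    partner x (residue m (i + e)) = residue m (partner x (residue m i) + e) := by
  have := hx.partner_mapBlocks (rotation m ^ e) (isNCConfig_rotation_pow hx e) (residue m i)
  rw [hfix, ← residue_add, residue_add_natCast] at this
  exact this

theorem IsNCConfig.cyclicLetter_periodic (hm : Odd m) {x : Finset (Finset (Fin m))}
    (hx : IsNCConfig x) {e : ℕ} (hfix : mapBlocks (rotation m ^ e) x = x) :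
    Function.Periodic (cyclicLetter x) (e : ℤ) := by
  intro i
  have h1 := cyclicLift_add hm (hx.partner_residue_add hfix) i
  have h2 := ball_mem_mapBlocks (rotation m ^ e) x (residue m i)
  rw [hfix, ← residue_add] at h2
  exact letterAt_congr (by rw [h1]; omega) (by rw [h1]; omega) h2

theorem cyclicLift_of_ball (hm : Odd m) {x : Finset (Finset (Fin m))} (hx : IsNCConfig x) (i : ℤ)
    (hi : {residue m i} ∈ x) : cyclicLift (partner x) i = i := by
  refine (eq_cyclicLift hm ?_ ?_ ?_).symm
  · rw [hx.partner_of_ball hi]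
  · have := NeZero.pos m
    omega
  · have := NeZero.pos m
    omega

theorem apply_residue_of_periodic {β : Type*} {f : ℤ → β} (hf : Function.Periodic f (m : ℤ))
    (i : ℤ) : f (residue m i : Fin m) = f i := by
  obtain ⟨q, hq⟩ := dvd_sub_residue (m := m) i
  have := hf.int_mul q (residue m i : Fin m)
  rw [← this]
  congr 1
  rw [Int.cast_id]
  linear_combination -hq

theorem periodic_ext {β : Type*} {e : ℕ} {f g : ℤ → β} (he : 0 < e)
    (hf : Function.Periodic f (e : ℤ)) (hg : Function.Periodic g (e : ℤ))
    (h : ∀ a : Fin e, f a = g a) : f = g := by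
  have : NeZero e := ⟨he.ne'⟩
  ext i
  rw [← apply_residue_of_periodic hf, ← apply_residue_of_periodic hg]
  exact h _

theorem IsNCConfig.cyclicWord_injective (hm : Odd m) {x y : Finset (Finset (Fin m))}
    (hx : IsNCConfig x) (hy : IsNCConfig y) {e : ℕ} (he : 3 * e ≤ m) (he0 : 0 < e)
    (hfx : mapBlocks (rotation m ^ e) x = x) (hfy : mapBlocks (rotation m ^ e) y = y)
    (h : cyclicWord e x = cyclicWord e y) : x = y := by
  have hL : cyclicLetter x = cyclicLetter y := periodic_ext he0 (hx.cyclicLetter_periodic hm hfx)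
    (hy.cyclicLetter_periodic hm hfy) (congrFun h)
  have hF : cyclicLift (partner x) = cyclicLift (partner y) :=
    (isNCInvolution_cyclicLift hm hx.isNCInvolution he he0
      (hx.partner_residue_add hfx)).eq_of_lt_iff (isNCInvolution_cyclicLift hm hy.isNCInvolution he
        he0 (hy.partner_residue_add hfy)) (fun i => (lt_iff_of_letterAt_eq (congrFun hL i)).1)
      (fun i => (lt_iff_of_letterAt_eq (congrFun hL i)).2)
  refine hx.eq_of_partner hy (fun a => ?_) fun a => ?_
  · have := congrArg (residue m) (congrFun hF a)
    rwa [residue_cyclicLift, residue_cyclicLift, residue_natCast] at this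
  · rw [← residue_natCast a, ← letterAt_eq_ball_iff (cyclicLift_of_ball hm hx a),
      ← letterAt_eq_ball_iff (cyclicLift_of_ball hm hy a)]
    exact Eq.congr_left (congrFun hL a)

/-- The two endpoints of an arc, reduced modulo `e`, contribute opposite steps. -/
theorem IsNCConfig.cyclicWord_mem_balancedWords (hm : Odd m) {x : Finset (Finset (Fin m))}
    (hx : IsNCConfig x) {e : ℕ} (he0 : 0 < e) (hfx : mapBlocks (rotation m ^ e) x = x) :
    cyclicWord e x ∈ balancedWords e := by
  have : NeZero e := ⟨he0.ne'⟩
  have hinv := cyclicLift_invol hm hx.partner_partner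
  have hper := hx.cyclicLetter_periodic hm hfx
  have hadd := cyclicLift_add hm (hx.partner_residue_add hfx)
  have hdper : Function.Periodic (fun i => cyclicLift (partner x) i - i) (e : ℤ) := by
    intro i
    dsimp only
    rw [hadd]
    ring
  have hres : ∀ i, cyclicLetter x (residue e i : Fin e) = cyclicLetter x i := by
    exact apply_residue_of_periodic hper
  have hneg : ∀ i, step (cyclicLetter x (cyclicLift (partner x) i)) = -step (cyclicLetter x i) := by
    intro i
    unfold cyclicLetter
    rw [step_letterAt, step_letterAt, hinv]
    split_ifs <;> first | rfl | (exfalso; order)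
  refine Finset.mem_filter.2 ⟨Finset.mem_univ _, ?_⟩
  change ∑ a : Fin e, step (cyclicLetter x a) = 0
  refine Finset.sum_involution (fun a _ => residue e (cyclicLift (partner x) a)) ?_ ?_ ?_ ?_
  · intro a _
    rw [hres, hneg, add_neg_cancel]
  · intro a _ h1 h2
    have := congrArg (fun a : Fin e => step (cyclicLetter x a)) h2
    rw [hres, hneg] at this
    omega
  · intro a _
    exact Finset.mem_univ _
  · intro a _
    have h1 := apply_residue_of_periodic hdper (cyclicLift (partner x) a)
    rw [hinv] at h1
    have h2 : residue e (cyclicLift (partner x) (residue e (cyclicLift (partner x) a) : Fin e)) =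
        residue e a := by
      rw [residue_eq_iff]
      have := dvd_sub_residue (m := e) (cyclicLift (partner x) a)
      rw [← dvd_neg, neg_sub]
      rwa [show (a : ℤ) - cyclicLift (partner x) (residue e (cyclicLift (partner x) a) : Fin e) =
        cyclicLift (partner x) a - (residue e (cyclicLift (partner x) a) : Fin e) by
        linear_combination -h1]
    rw [h2, residue_natCast]

/-- A word of total height zero has a periodic height function, whose noncrossing involution is
periodic with arcs shorter than the period, and so descends to `Fin m`. -/
theorem exists_cyclicWord_eq (hm : Odd m) {e : ℕ} (he : 3 * e ≤ m) (he0 : 0 < e) (hem : e ∣ m)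
    {w : Fin e → Letter} (hw : w ∈ balancedWords e) :
    ∃ x, (IsNCConfig x ∧ mapBlocks (rotation m ^ e) x = x) ∧ cyclicWord e x = w := by
  have : NeZero e := ⟨he0.ne'⟩
  have hw0 : height w e = 0 := by
    have := (Finset.mem_filter.1 hw).2
    simpa [height] using this
  let h : ℤ → ℤ := fun i => height w (residue e i : Fin e)
  have hres1 : ∀ i : ℤ, residue e (i + e) = residue e i := fun i => by
    rw [residue_eq_iff, add_sub_cancel_left]
  have hper : ∀ i, h (i + e) = h i := by
    intro i
    change height w (residue e (i + e) : Fin e) = _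
    rw [hres1]
  have hstep : ∀ i, h (i + 1) = h i + step (w (residue e i)) := by
    intro i
    have h1 := height_succ w (residue e i).2
    have h2 : height w (residue e (i + 1) : Fin e) = height w ((residue e i).val + 1) := by
      have h3 := residue_add (m := e) i 1
      rw [pow_one, Nat.cast_one] at h3
      rw [h3, rotation_val]
      split_ifs with h4
      · rw [h4, hw0, height_zero]
      · rfl
    exact h2.trans h1
  have hstep1 : ∀ a : Letter, -1 ≤ step a ∧ step a ≤ 1 := by decide
  obtain ⟨f, hf, hf1, hf2⟩ := exists_isNCInvolution h
    (fun i => by rw [hstep]; have := hstep1 (w (residue e i)); omega)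
    (fun i => by rw [hstep]; have := hstep1 (w (residue e i)); omega)
    (fun i hi => by
      have h1 := hper i
      have : e ≠ 1 := by
        rintro rfl
        rw [Nat.cast_one] at h1
        omega
      exact ⟨i + e - 1, by omega, by rw [sub_add_cancel, h1]⟩)
    (fun j hj => by
      have h1 := hper (j + 1 - e)
      rw [sub_add_cancel] at h1
      have : e ≠ 1 := by
        rintro rfl
        rw [Nat.cast_one, add_sub_cancel_right] at h1
        omega
      exact ⟨j + 1 - e, by omega, by rw [h1]⟩)
  have hsg1 : ∀ i, i < f i ↔ 0 < step (w (residue e i)) := fun i => by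
    rw [hf1, hstep]
    omega
  have hsg2 : ∀ i, f i < i ↔ step (w (residue e i)) < 0 := fun i => by
    rw [hf2, hstep]
    omega
  -- The shifted involution has the same endpoints, so uniqueness makes `f` periodic.
  have hfper : ∀ i, f (i + e) = f i + e := by
    have hg : IsNCInvolution fun i => f (i + e) - e := by
      refine ⟨fun i => ?_, fun i j h1 h2 h3 => ?_⟩
      · rw [sub_add_cancel, hf.invol, add_sub_cancel_right]
      · exact hf.noncrossing (i + e) (j + e) (by omega) (by omega) (by omega)
    have := hf.eq_of_lt_iff hg
      (fun i => by
        have := hsg1 i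
        have h2 := hsg1 (i + e)
        rw [hres1] at h2
        omega)
      (fun i => by
        have := hsg2 i
        have h2 := hsg2 (i + e)
        rw [hres1] at h2
        omega)
    intro i
    have h2 := congrFun this i
    omega
  have hshort : ∀ i, f i < i + e := by
    intro i
    by_contra hc
    have h3 := hfper i
    rcases eq_or_lt_of_le (not_lt.1 hc) with h2 | h2
    · rw [h2, hf.invol] at h3
      omega
    · exact hf.noncrossing i (i + e) (by omega) h2 (by omega)
  have hshort' : ∀ i, i < f i + e := by
    intro i
    have := hshort (f i)
    rwa [hf.invol] at this
  have hDper : Function.Periodic (fun i => f i - i) (m : ℤ) := by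
    have h1 : Function.Periodic (fun i => f i - i) (e : ℤ) := by
      intro i
      dsimp only
      rw [hfper]
      ring
    obtain ⟨d, rfl⟩ := hem
    have := h1.nat_mul d
    rwa [mul_comm, ← Nat.cast_mul] at this
  let p : Fin m → Fin m := fun a => residue m (f a)
  have hpres : ∀ i, residue m (f i) = p (residue m i) := by
    intro i
    have h1 := apply_residue_of_periodic hDper i
    change _ = residue m (f (residue m i : Fin m))
    rw [residue_eq_iff]
    have := dvd_sub_residue (m := m) i
    convert this using 1
    linear_combination -h1
  have hfm : ∀ i, f (i + m) = f i + m := by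
    intro i
    have := hDper i
    dsimp only at this
    linear_combination this
  have hpNC : IsNCInvolution p := by
    refine ⟨fun a => ?_, fun a b h1 h2 h3 => ?_⟩
    · change p (residue m (f a)) = a
      rw [← hpres, hf.invol, residue_natCast]
    · -- An arc of `p` is short either directly or across the point `0`.
      have hlift : ∀ a : Fin m, a < p a → f a = p a ∨ f (p a) = a + m := by
        intro a ha
        rw [Fin.lt_def] at ha
        have h4 := hshort a
        have h5 := hshort' a
        have h6 := (p a).2
        rcases lt_or_ge (f a) 0 with h7 | h7
        · right
          have : f a + m = p a := by
            refine eq_of_residue_eq (m := m) ?_ (by omega) (by omega)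
            rw [residue_natCast, (residue_eq_iff _ _).2 (show (m : ℤ) ∣ f a + m - f a by simp)]
          rw [← this, hfm, hf.invol]
        · left
          refine eq_of_residue_eq (m := m) ?_ (by omega) (by omega)
          rw [residue_natCast]
      rw [Fin.lt_def] at h1 h2 h3
      have ha := (p a).2
      have hb := (p b).2
      have e3 := hf.invol (p a)
      have e4 := hf.invol (p b)
      have hsb := hfm (p b - m)
      rw [sub_add_cancel] at hsb
      rcases hlift a (by rw [Fin.lt_def]; omega) with e1 | e1 <;>
        rcases hlift b (by rw [Fin.lt_def]; omega) with e2 | e2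
      · exact hf.noncrossing a b (by omega) (by omega) (by omega)
      · exact hf.noncrossing (p b - m) a (by omega) (by omega) (by omega)
      · exact hf.noncrossing b (p a) (by omega) (by omega) (by omega)
      · exact hf.noncrossing (p a) (p b) (by omega) (by omega) (by omega)
  have hlift : cyclicLift p = f := by
    ext i
    have h1 := hshort i
    have h2 := hshort' i
    exact (eq_cyclicLift hm (hpres i) (by omega) (by omega)).symm
  let B : Fin m → Prop := fun a => w (residue e a) = (false, true)
  have hB : ∀ a, B a → p a = a := by
    intro a ha
    change residue m (f a) = a
    rw [eq_of_step_eq_zero (hsg1 a) (hsg2 a) ha, residue_natCast]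
  have hx := isNCConfig_configOf hpNC hB
  have hpart : partner (configOf p B) = p := funext (partner_configOf hpNC hB)
  have hBres : ∀ i : ℤ, B (residue m i) ↔ w (residue e i) = (false, true) := by
    intro i
    change w (residue e (residue m i : Fin m)) = _ ↔ _
    rw [(residue_eq_iff _ _).2 (show (e : ℤ) ∣ (residue m i : Fin m) - i from
      (Int.natCast_dvd_natCast.2 hem).trans (dvd_sub_comm.1 (dvd_sub_residue i)))]
  refine ⟨configOf p B, ⟨hx, ?_⟩, ?_⟩
  · have hx2 := isNCConfig_rotation_pow hx e
    refine hx2.eq_of_partner hx (fun a => ?_) fun a => ?_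
    · obtain ⟨b, rfl⟩ := (rotation m ^ e).surjective a
      rw [hx.partner_mapBlocks _ hx2, hpart]
      change (rotation m ^ e) (residue m (f b)) = _
      rw [← residue_add, residue_add_natCast, ← hpres, hfper]
    · obtain ⟨b, rfl⟩ := (rotation m ^ e).surjective a
      rw [ball_mem_mapBlocks, ball_mem_configOf, ball_mem_configOf, residue_add_natCast, hBres,
        hres1]
  · ext1 a
    rw [cyclicWord, hpart, hlift, ball_mem_configOf, propext (hBres a),
      letterAt_eq_of_step (hsg1 a) (hsg2 a), residue_natCast]

/-- The number of configurations fixed by a rotation of order `m / e ≥ 3`. -/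
theorem card_fixed_rotation (hm : Odd m) {e : ℕ} (he : 3 * e ≤ m) (he0 : 0 < e) (hem : e ∣ m) :
    Nat.card {x : {x : Finset (Finset (Fin m)) // IsNCConfig x} //
      mapBlocks (rotation m ^ e) x.1 = x.1} = (2 * e).choose e := by
  rw [← card_balancedWords, ← Fintype.card_coe, ← Nat.card_eq_fintype_card]
  refine Nat.card_eq_of_bijective (fun x => (⟨cyclicWord e x.1.1,
    x.1.2.cyclicWord_mem_balancedWords hm he0 x.2⟩ : {w // w ∈ balancedWords e})) ⟨?_, ?_⟩
  · intro x y h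
    exact Subtype.ext (Subtype.ext (x.1.2.cyclicWord_injective hm y.1.2 he he0 x.2 y.2
      (congrArg Subtype.val h)))
  · rintro ⟨w, hw⟩
    obtain ⟨x, ⟨hx, hfix⟩, rfl⟩ := exists_cyclicWord_eq hm he he0 hem hw
    exact ⟨⟨⟨x, hx⟩, hfix⟩, rfl⟩

end Rotation

/-! ### Fixed points and the sieving identity -/

section Sieving

open DihedralGroup ZMod

theorem charHom_conj {G : Type} [Group G] (g h : G) {V : Type} [AddCommGroup V] [Module ℂ V]
    [Module.Finite ℂ V] (ρ : Representation ℂ G V) :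
    charHom (h * g * h⁻¹) (repClass ρ) = charHom g (repClass ρ) := by
  rw [charHom_repClass, charHom_repClass, map_mul, LinearMap.trace_mul_comm, ← map_mul]
  group

theorem charHom_aeval {G : Type} [Group G] (g : G) (a b : RepRing G)
    (P : MvPolynomial (Fin 2) ℤ) : charHom g (MvPolynomial.aeval ![a, b] P) =
      MvPolynomial.aeval ![charHom g a, charHom g b] P := by
  have h := MvPolynomial.map_aeval ![a, b] (charHom g) P
  rw [h, MvPolynomial.aeval_def, MvPolynomial.coe_eval₂Hom]
  congr 1
  · exact RingHom.ext_int _ _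
  · ext i
    fin_cases i <;> rfl

theorem mapBlocks_pow_eq {m : ℕ} {σ : Equiv.Perm (Fin m)} {x : Finset (Finset (Fin m))}
    (h : mapBlocks σ x = x) (k : ℕ) : mapBlocks (σ ^ k) x = x := by
  induction k with
  | zero => rw [pow_zero, mapBlocks_one]
  | succ k ih => rw [pow_succ, mapBlocks_mul, h, ih]

variable {m : ℕ} [NeZero m]

theorem vertexHom_r (i : ZMod m) : vertexHom m (r i) = rotation m ^ i.val :=
  dihedralLift_r _ _ _ _ _ _

theorem vertexHom_sr_zero : vertexHom m (sr 0) = reflection m := by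
  refine (dihedralLift_sr _ _ _ _ _ _).trans ?_
  rw [ZMod.val_zero, pow_zero, mul_one]

theorem rotation_pow_card (m : ℕ) : rotation m ^ m = 1 := by
  ext i
  rw [rotation_pow_val]
  simp [Nat.mod_eq_of_lt i.2]

/-- A power of the rotation fixes the same configurations as the power whose exponent is the
greatest common divisor with `m`. -/
theorem mapBlocks_rotation_pow_gcd (k : ℕ) (x : Finset (Finset (Fin m))) :
    mapBlocks (rotation m ^ k) x = x ↔ mapBlocks (rotation m ^ k.gcd m) x = x := by
  constructor
  · intro h
    obtain ⟨a, ha⟩ : ∃ a, rotation m ^ k.gcd m = (rotation m ^ k) ^ a := by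
      have h1 := Nat.gcd_eq_gcd_ab k m
      refine ⟨(k.gcdA m % m).toNat, ?_⟩
      have hm0 : (m : ℤ) ≠ 0 := by exact_mod_cast NeZero.ne m
      have h2 := Int.emod_nonneg (k.gcdA m) hm0
      rw [← pow_mul, ← zpow_natCast, ← zpow_natCast, h1, Nat.cast_mul, Int.toNat_of_nonneg h2,
        Int.emod_def, zpow_add, zpow_mul _ (m : ℤ), zpow_natCast _ m, rotation_pow_card, one_zpow,
        mul_one, show (k : ℤ) * (k.gcdA m - m * (k.gcdA m / m)) =
          k * k.gcdA m + m * (-(k * (k.gcdA m / m))) by ring, zpow_add, zpow_mul _ (m : ℤ),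
        zpow_natCast _ m, rotation_pow_card, one_zpow, mul_one]
    rw [ha]
    exact mapBlocks_pow_eq h a
  · intro h
    obtain ⟨c, hc⟩ := Nat.gcd_dvd_left k m
    have h1 := mapBlocks_pow_eq h c
    rwa [← pow_mul, ← hc] at h1

theorem isPrimitiveRoot_stdAddChar {i : ZMod m} (hi : i ≠ 0) :
    IsPrimitiveRoot (stdAddChar i : ℂ) (m / i.val.gcd m) := by
  have hp := isPrimitiveRoot_stdAddChar_one (m := m)
  have h1 : (stdAddChar i : ℂ) = stdAddChar (1 : ZMod m) ^ i.val := by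
    rw [← AddChar.map_nsmul_eq_pow, nsmul_one, ZMod.natCast_zmod_val]
  have h2 := orderOf_pow' (stdAddChar (1 : ZMod m) : ℂ) ((ZMod.val_ne_zero i).2 hi)
  rw [← hp.eq_orderOf, ← h1, Nat.gcd_comm] at h2
  rw [← h2]
  exact IsPrimitiveRoot.orderOf _

/-- The number of configurations fixed by a rotation. -/
theorem card_fixed_r (hm : Odd m) (i : ZMod m) :
    (Nat.card {x : {x : Finset (Finset (Fin m)) // IsNCConfig x} //
      mapBlocks (vertexHom m (r i)) x.1 = x.1} : ℂ) =
      MvPolynomial.aeval ![stdAddChar i + stdAddChar (-i), -1] (fibCatalanPoly m) := by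
  by_cases hi : i = 0
  · have h0 : ∀ x : {x : Finset (Finset (Fin m)) // IsNCConfig x},
        mapBlocks (vertexHom m (r i)) x.1 = x.1 := by
      intro x
      rw [hi, ← one_def, map_one, mapBlocks_one]
    rw [Nat.card_congr (Equiv.subtypeUnivEquiv h0), card_config]
    have h1 := aeval_fibCatalanPoly_two m
    have h2 : ((ballotWords m 0).card : ℂ) * ((m + 1).factorial * (m + 2).factorial) =
        (2 * m + 2).factorial := by exact_mod_cast card_ballotWords_mul_factorial m
    rw [hi, neg_zero, AddChar.map_zero_eq_one, one_add_one_eq_two]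
    refine mul_right_cancel₀ (mul_ne_zero ?_ ?_) (h2.trans h1.symm) <;>
      exact Nat.cast_ne_zero.2 (Nat.factorial_ne_zero _)
  · have hv : 0 < i.val := Nat.pos_of_ne_zero ((ZMod.val_ne_zero i).2 hi)
    have hlt := ZMod.val_lt i
    have he0 : 0 < i.val.gcd m := Nat.gcd_pos_of_pos_left _ hv
    have hle := Nat.gcd_le_left m hv
    obtain ⟨d, hd⟩ := Nat.gcd_dvd_right i.val m
    have hdiv : m / i.val.gcd m = d := Nat.div_eq_of_eq_mul_right he0 hd
    have hdodd : Odd d := Odd.of_dvd_nat hm (Dvd.intro_left _ hd.symm)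
    have hd3 : 3 ≤ d := by
      have h1 : d ≠ 1 := by
        rintro rfl
        omega
      obtain ⟨t, ht⟩ := hdodd
      omega
    have hroot := isPrimitiveRoot_stdAddChar hi
    rw [hdiv] at hroot
    have hval := aeval_fibCatalanPoly_root hroot hdodd hd3 (i.val.gcd m)
    rw [mul_comm d, ← hd] at hval
    have h3 : 3 * i.val.gcd m ≤ m := by
      rw [mul_comm]
      exact (Nat.mul_le_mul_left _ hd3).trans hd.ge
    rw [AddChar.map_neg_eq_inv, hval, ← card_fixed_rotation hm h3 he0 (Nat.gcd_dvd_right _ _)]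
    simp only [vertexHom_r]
    exact congrArg Nat.cast (Nat.card_congr (Equiv.subtypeEquivRight
      fun x : {x : Finset (Finset (Fin m)) // IsNCConfig x} =>
        mapBlocks_rotation_pow_gcd i.val x.1))

/-- The number of configurations fixed by the reflection. -/
theorem card_fixed_sr_zero (hm : Odd m) :
    (Nat.card {x : {x : Finset (Finset (Fin m)) // IsNCConfig x} //
      mapBlocks (vertexHom m (sr 0)) x.1 = x.1} : ℂ) =
      MvPolynomial.aeval ![0, 1] (fibCatalanPoly m) := by
  obtain ⟨L, rfl⟩ := hm
  rw [aeval_fibCatalanPoly_zero_one (2 * L + 1) (L + 1) (by ring), ← card_symmetricWords,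
    ← card_fixed_reflection]
  simp only [vertexHom_sr_zero]

/-- For odd `m` all reflections are conjugate. -/
theorem exists_conj_sr_zero (hm : Odd m) (i : ZMod m) :
    ∃ h : DihedralGroup m, sr i = h * sr 0 * h⁻¹ := by
  obtain ⟨b, hb⟩ : ∃ b : ZMod m, i = b + b := by
    rcases Nat.even_or_odd i.val with h | h
    · obtain ⟨b, hb⟩ := h
      exact ⟨b, by rw [← Nat.cast_add, ← hb, ZMod.natCast_zmod_val]⟩
    · obtain ⟨b, hb⟩ := h.add_odd hm
      exact ⟨b, by rw [← Nat.cast_add, ← hb, Nat.cast_add, ZMod.natCast_zmod_val,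
        ZMod.natCast_self, add_zero]⟩
  refine ⟨r (-b), ?_⟩
  rw [inv_r, r_mul_sr, sr_mul_r, hb]
  ring_nf

theorem card_smul_eq (n : ℕ) (g : DihedralGroup (n - 1)) :
    Nat.card {x : NCConfig n // g • x = x} =
      Nat.card {x : {x : Finset (Finset (Fin (n - 1))) // IsNCConfig x} //
        mapBlocks (vertexHom (n - 1) g) x.1 = x.1} :=
  Nat.card_congr (Equiv.subtypeEquivRight fun _ => Subtype.ext_iff)

theorem repClass_ofMulAction (n : ℕ) [NeZero (n - 1)] (hm : Odd (n - 1)) :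
    repClass (Representation.ofMulAction ℂ (DihedralGroup (n - 1)) (NCConfig n)) =
      MvPolynomial.aeval ![repClass (z1 (n - 1)), -repClass (detRep (n - 1))]
        (fibCatalanPoly (n - 1)) := by
  apply eq_of_charHom_eq hm
  rintro (i | i)
  · rw [charHom_aeval, charHom_ofMulAction, card_smul_eq, card_fixed_r hm, charHom_z1_r,
      map_neg (charHom (r i)), charHom_detRep_r]
  · obtain ⟨h, hh⟩ := exists_conj_sr_zero hm i
    rw [charHom_aeval, charHom_z1_sr, map_neg, charHom_detRep_sr, neg_neg, hh, charHom_conj,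
      charHom_ofMulAction, card_smul_eq, card_fixed_sr_zero hm]

end Sieving

end DihedralSieving

open DihedralSieving in
theorem mainTheorem3 (n : ℕ) (hpos : 0 < n) (hn : Even n) :
    ∃ P : MvPolynomial (Fin 2) ℤ,
      algebraMap (MvPolynomial (Fin 2) ℤ) (FractionRing (MvPolynomial (Fin 2) ℤ)) P =
        fibCatalan n ∧
      ExhibitsSieving (NCConfig n) (DihedralGroup (n - 1))
        ![repClass (z1 (n - 1)), -repClass (detRep (n - 1))] P := by
  have hm : Odd (n - 1) := by
    obtain ⟨k, rfl⟩ := hn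
    exact ⟨k - 1, by omega⟩
  have : NeZero (n - 1) := ⟨by obtain ⟨k, hk⟩ := hm; omega⟩
  refine ⟨fibCatalanPoly (n - 1), ?_, adjoin_z1_det hm, repClass_ofMulAction n hm⟩
  rw [algebraMap_fibCatalanPoly, Nat.sub_add_cancel hpos]
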